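/- For complex $s,v$ with $v\notin\{0,-1,-2,\dots\}$ let $\Phi(z,s,v)$ be the Hurwitz–Lerch zeta function: for $|z|<1$ it is $\sum_{j\ge 0}(v+j)^{-s}z^{j}$ (principal powers); for $z\in\mathbb C\setminus[1,\infty)$ it is the analytic continuation of this series in $z$; for $z=1$ and $s\ne 1$ it is the Hurwitz zeta function $\zeta(s,v)$, i.e. the analytic continuation in $s$ of $\sum_{j\ge0}(v+j)^{-s}$; and for $s\in\{0,-1,-2,\dots\}$, where $\Phi$ is a rational function of $z$, it is also defined by continuity for $z\in(1,\infty)$. **Theorem.** Let $k,a,m\in\mathbb C$ with $a\neq0$, let $n$ be a positive integer, and let $\log a$ be any value of the logarithm of $a$. Suppose that all the values of $\Phi$ below are defined in the above sense. Then, with principal values of the powers, $$\sum_{p=0}^{n}2^{-p}e^{im2^{-p}}\Bigl((i2^{-p})^{k}e^{im2^{-p}}\,\Phi\bigl(-e^{i2^{1-p}m},-k,1-i2^{p-1}\log a\bigr)-(i2^{-p-1})^{k}\,\Phi\bigl(-e^{i2^{-p}m},-k,1-i2^{p}\log a\bigr)\Bigr)$$ $$=i\,(i2^{-n})^{k+1}e^{im2^{-n}}\,\Phi\Bigl(e^{i2^{1-n}m},-k,\tfrac12\bigl(1-i2^{n}\log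 a\bigr)\Bigr)+i^{k}2^{k+1}e^{2im}\,\Phi\Bigl(e^{4im},-k,\tfrac12-\tfrac14 i\log a\Bigr).$$ -/

import Mathlib

/-- The Lerch series `∑ (v + j)^(-s) z^j`, with principal powers. -/
noncomputable def lerchSeries (z s v : ℂ) : ℂ :=
  ∑' j : ℕ, (v + (j : ℂ)) ^ (-s) * z ^ j

/-- The plane cut along the ray `[1, ∞)`. -/
def lerchCutPlane : Set ℂ := {z : ℂ | 1 - z ∈ Complex.slitPlane}

/-- `f` is the analytic continuation in `z` of the Lerch series from the unit disc to the plane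
cut along `[1, ∞)`. -/
def IsLerchContinuation (s v : ℂ) (f : ℂ → ℂ) : Prop :=
  DifferentiableOn ℂ f lerchCutPlane ∧ ∀ z : ℂ, ‖z‖ < 1 → f z = lerchSeries z s v

/-- `g` is the Hurwitz zeta function `s ↦ ζ(s, v)`: the analytic continuation in `s`, to the
plane without the point `1`, of the series at `z = 1`, which converges for `Re s > 1`. -/
def IsHurwitzContinuation (v : ℂ) (g : ℂ → ℂ) : Prop :=
  DifferentiableOn ℂ g {(1 : ℂ)}ᶜ ∧ ∀ s : ℂ, 1 < s.re → g s = lerchSeries 1 s v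

open Classical in
/-- The Hurwitz-Lerch zeta function `Φ(z, s, v)`. Both continuations are unique on their
(connected) domains, so the value does not depend on the choice made by `epsilon`. For `z` off
the cut `[1, ∞)` the limit below is just the value at `z` of the continuation; at a point `z > 1`
of the cut it is the value to which the continuation extends continuously across the cut, if there
is one (as there is when `s = 0, -1, -2, …`, where `Φ` is a rational function of `z`).
The value is meaningful under `LerchAdmissible z s v` only. -/
noncomputable def hurwitzLerchPhi (z s v : ℂ) : ℂ :=
  if z = 1 then Classical.epsilon (IsHurwitzContinuation v) s
  else Filter.limUnder (nhdsWithin z lerchCutPlane) (Classical.epsilon (IsLerchContinuation s v))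

/-- The points at which `Φ(z, s, v)` is defined: `v` is not one of `0, -1, -2, …`, and either `z`
is off the cut `[1, ∞)`, or `z = 1` and `s` is not the pole `1` of the Hurwitz zeta function, or
`z ≠ 1` and `s` is one of `0, -1, -2, …`. -/
def LerchAdmissible (z s v : ℂ) : Prop :=
  (∀ j : ℕ, v ≠ -(j : ℂ)) ∧
    (z ∈ lerchCutPlane ∨ (z = 1 ∧ s ≠ 1) ∨ (z ≠ 1 ∧ ∃ N : ℕ, s = -(N : ℂ)))

/-! The algebra is a telescoping sum. Splitting a Lerch series by the parity of the index
(`lerchSeries_even_odd`) expresses it at `(z, v)` through series at `(z², v/2)` and `(z², (v+1)/2)`.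
Let `F_p` be the normalised series `fullLerch`, with `z = e^{i2^{1-p}m}` and `v = 1 - i2^{p-1} log
a`. Its odd half is `F_{p-1}/2`. Hence replacing `z` by `-z` gives `A_p = F_p - F_{p-1}`
(`alternatingLerch_eq`), while the even halves are given by `O_p = 2F_{p+1} - F_p`
(`two_mul_fullLerch_sub`). The `p`-th summand is `A_p - 2A_{p+1} = O_{p-1} - O_p`, and the sum is
`O_{-1} - O_n`.

This is valid where all the series converge absolutely: `Im m > 0`, or `m` real and `Re k < -1`.
`sum_hurwitzLerchPhi_eq_zero` carries any such linear relation to all admissible values. Off the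
real axis it continues in `m`, along vertical strips if no point meets the cut; a point on the cut
forces `k` to be a natural number, where `Φ` is rational. For real `m` it continues in `k`, because
the Hurwitz value at `z = 1` is not a continuation in `z`.

The definition of `Φ` chooses a continuation, so existence and uniqueness must be proved. In `z`,
existence comes from a Mellin integral (`lerchIntegral`) after finitely many terms are removed; at
`z = 1`, from subtracting the expansion of `(1 - e^{-t})⁻¹` at `0` (`exists_hurwitz_entire`). -/

open Complex MeasureTheory Filter Topology Set Asymptotics

/-! ### Holomorphic parameter integrals and the Gamma integral. -/

/-- An integral depending holomorphically on a parameter, with local domination, is holomorphic. -/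
theorem differentiableOn_integral_of_locally_dominated {α : Type*} [MeasurableSpace α]
    {μ : Measure α} {F : ℂ → α → ℂ} {U : Set ℂ} (hU : IsOpen U)
    (hmeas : ∀ z ∈ U, AEStronglyMeasurable (F z) μ)
    (hdiff : ∀ᵐ t ∂μ, DifferentiableOn ℂ (fun z => F z t) U)
    (hbound : ∀ z₀ ∈ U, ∃ V ∈ 𝓝 z₀, ∃ b : α → ℝ, Integrable b μ ∧
      ∀ᵐ t ∂μ, ∀ z ∈ V, ‖F z t‖ ≤ b t) :
    DifferentiableOn ℂ (fun z => ∫ t, F z t ∂μ) U := by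
  intro z₀ hz₀
  obtain ⟨V, hV, b, hb, hFb⟩ := hbound z₀ hz₀
  obtain ⟨ε, hε, hεV⟩ := Metric.mem_nhds_iff.1 (inter_mem hV (hU.mem_nhds hz₀))
  have hball : ∀ z ∈ Metric.ball z₀ (ε / 2), Metric.closedBall z (ε / 4) ⊆ V ∩ U := by
    intro z hz w hw
    apply hεV
    rw [Metric.mem_ball] at hz ⊢
    rw [Metric.mem_closedBall] at hw
    linarith [dist_triangle w z z₀]
  have hderiv : ∀ᵐ t ∂μ, ∀ z ∈ Metric.ball z₀ (ε / 2),
      HasDerivAt (fun z => F z t) (deriv (fun z => F z t) z) z := by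
    filter_upwards [hdiff] with t ht z hz
    have hzU : z ∈ U := (hball z hz (Metric.mem_closedBall_self (by positivity))).2
    exact ((ht z hzU).differentiableAt (hU.mem_nhds hzU)).hasDerivAt
  have hz₀' : z₀ ∈ Metric.ball z₀ (ε / 2) := Metric.mem_ball_self (by positivity)
  -- The derivative is measurable in `t` as a pointwise limit of difference quotients along a real
  -- sequence.
  have hmeas' : AEStronglyMeasurable (fun t => deriv (fun z => F z t) z₀) μ := by
    obtain ⟨u, -, hu_mem, hu⟩ := exists_seq_strictAnti_tendsto' (α := ℝ) (x := 0) (y := ε)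
      (by positivity)
    have hmem : ∀ n, z₀ + (u n : ℂ) ∈ U := fun n => (hεV (by
      simpa [abs_of_pos (hu_mem n).1] using (hu_mem n).2)).2
    refine aestronglyMeasurable_of_tendsto_ae atTop
      (f := fun n t => (u n : ℂ)⁻¹ • (F (z₀ + u n) t - F z₀ t))
      (fun n => ((hmeas _ (hmem n)).sub (hmeas _ hz₀)).const_smul (u n : ℂ)⁻¹) ?_
    filter_upwards [hderiv] with t ht
    have h := (hasDerivAt_iff_tendsto_slope_zero.1 (ht z₀ hz₀'))
    refine h.comp (tendsto_nhdsWithin_iff.2 ⟨?_, Eventually.of_forall fun n => ?_⟩)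
    · have h0 := (continuous_ofReal.tendsto 0).comp hu
      rwa [ofReal_zero] at h0
    · simpa using (hu_mem n).1.ne'
  -- The bound on the derivative is Cauchy's estimate on circles of radius `ε / 4`.
  refine (hasDerivAt_integral_of_dominated_loc_of_deriv_le (bound := fun t => b t / (ε / 4))
    (F' := fun z t => deriv (fun z => F z t) z)
    (Metric.ball_mem_nhds z₀ (by positivity : 0 < ε / 2)) ?_ ?_ hmeas' ?_ (hb.div_const _)
    hderiv).2.differentiableAt.differentiableWithinAt
  · filter_upwards [hU.mem_nhds hz₀] with z hz using hmeas z hz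
  · refine hb.mono' (hmeas _ hz₀) ?_
    filter_upwards [hFb] with t ht using ht z₀ (mem_of_mem_nhds hV)
  · filter_upwards [hFb, hdiff] with t ht htd z hz
    refine norm_deriv_le_of_forall_mem_sphere_norm_le (by positivity) ?_ ?_
    · refine (htd.mono ?_).diffContOnCl
      rw [closure_ball _ (by positivity)]
      exact fun w hw => (hball z hz hw).2
    · exact fun w hw => ht w (hball z hz (Metric.sphere_subset_closedBall hw)).1

theorem integrableOn_rpow_mul_exp_neg_mul {σ r : ℝ} (hσ : 0 < σ) (hr : 0 < r) :
    IntegrableOn (fun t : ℝ => t ^ (σ - 1) * Real.exp (-(r * t))) (Ioi 0) := by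
  have h := integrableOn_rpow_mul_exp_neg_mul_rpow (s := σ - 1) (p := 1) (b := r) (by linarith)
    one_pos hr
  simpa using h

theorem norm_cpow_mul_exp_neg_mul {t : ℝ} (ht : 0 < t) (s v : ℂ) :
    ‖(t : ℂ) ^ (s - 1) * exp (-(v * t))‖ = t ^ (s.re - 1) * Real.exp (-(v.re * t)) := by
  rw [norm_mul, norm_cpow_eq_rpow_re_of_pos ht, norm_exp]
  simp

theorem continuousOn_cpow_mul_exp_neg_mul (s v : ℂ) :
    ContinuousOn (fun t : ℝ => (t : ℂ) ^ (s - 1) * exp (-(v * t))) (Ioi 0) := by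
  intro t ht
  have := continuousAt_ofReal_cpow_const t (s - 1) (Or.inr (ne_of_gt ht))
  exact (this.mul (by fun_prop)).continuousWithinAt

theorem integrableOn_cpow_mul_exp_neg_mul {s v : ℂ} (hs : 0 < s.re) (hv : 0 < v.re) :
    IntegrableOn (fun t : ℝ => (t : ℂ) ^ (s - 1) * exp (-(v * t))) (Ioi 0) := by
  refine (integrableOn_rpow_mul_exp_neg_mul hs hv).mono'
    ((continuousOn_cpow_mul_exp_neg_mul s v).aestronglyMeasurable measurableSet_Ioi) ?_
  filter_upwards [ae_restrict_mem measurableSet_Ioi] with t ht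
  exact (norm_cpow_mul_exp_neg_mul ht s v).le

/-- The Gamma integral `∫ t^(s-1) e^(-vt) dt` for complex `v` in the right half-plane. -/
theorem integral_cpow_mul_exp_neg_mul_complex {s v : ℂ} (hs : 0 < s.re) (hv : 0 < v.re) :
    ∫ t : ℝ in Ioi 0, (t : ℂ) ^ (s - 1) * exp (-(v * t)) = Gamma s * v ^ (-s) := by
  have hopen : IsOpen {v : ℂ | 0 < v.re} := isOpen_lt continuous_const continuous_re
  have h1 : DifferentiableOn ℂ
      (fun v : ℂ => ∫ t : ℝ in Ioi 0, (t : ℂ) ^ (s - 1) * exp (-(v * t))) {v : ℂ | 0 < v.re} := by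
    refine differentiableOn_integral_of_locally_dominated hopen (fun v _ =>
      (continuousOn_cpow_mul_exp_neg_mul s v).aestronglyMeasurable measurableSet_Ioi) ?_ ?_
    · exact Eventually.of_forall fun t => by fun_prop
    · intro v hv
      have hv' : 0 < v.re := hv
      refine ⟨{w | v.re / 2 < w.re}, (isOpen_lt continuous_const continuous_re).mem_nhds
        (show v.re / 2 < v.re by linarith), _,
        integrableOn_rpow_mul_exp_neg_mul hs (half_pos hv'), ?_⟩
      filter_upwards [ae_restrict_mem measurableSet_Ioi] with t ht w hw
      have ht' : 0 < t := ht
      have hw' : v.re / 2 < w.re := hw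
      rw [norm_cpow_mul_exp_neg_mul ht]
      gcongr
  have h2 : DifferentiableOn ℂ (fun v : ℂ => Gamma s * v ^ (-s)) {v : ℂ | 0 < v.re} := by
    intro v hv
    exact ((differentiableAt_id.cpow_const (Or.inl hv)).const_mul _).differentiableWithinAt
  -- Both sides are holomorphic in `v`; they agree at positive real `v`, and the points `1 +
  -- 1/(n+1)` accumulate at `1`.
  refine (h1.analyticOnNhd hopen).eqOn_of_preconnected_of_frequently_eq (h2.analyticOnNhd hopen)
    (convex_halfSpace_re_gt 0).isPreconnected (z₀ := 1) (by simp) ?_ hv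
  have hreal : ∀ r : ℝ, 0 < r →
      ∫ t : ℝ in Ioi 0, (t : ℂ) ^ (s - 1) * exp (-((r : ℂ) * t)) = Gamma s * (r : ℂ) ^ (-s) := by
    intro r hr
    rw [integral_cpow_mul_exp_neg_mul_Ioi hs hr, mul_comm, one_div, inv_cpow, cpow_neg]
    rw [arg_ofReal_of_nonneg hr.le]
    exact Real.pi_pos.ne
  have htend : Tendsto (fun n : ℕ => ((1 + 1 / ((n : ℝ) + 1) : ℝ) : ℂ)) atTop (𝓝[≠] 1) := by
    refine tendsto_nhdsWithin_iff.2 ⟨?_, Eventually.of_forall fun n => ?_⟩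
    · have := (tendsto_one_div_add_atTop_nhds_zero_nat (𝕜 := ℝ)).const_add 1
      have h := (continuous_ofReal.tendsto _).comp this
      rwa [add_zero, ofReal_one] at h
    · have : (0 : ℝ) < 1 / ((n : ℝ) + 1) := by positivity
      rw [mem_compl_singleton_iff, ← ofReal_one, Ne, ofReal_inj]
      linarith
  exact htend.frequently (Frequently.of_forall fun n => hreal _ (by positivity))

/-- Termwise Mellin transform of `e^(-vt) ∑ aⱼ e^(-jt)`. -/
theorem hasSum_mellin_exp_neg_mul {s v : ℂ} (hs : 0 < s.re) (hv : 0 < v.re) {a : ℕ → ℂ}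
    {F : ℝ → ℂ} (hF : ∀ t : ℝ, 0 < t → HasSum (fun j : ℕ => a j * exp (-t) ^ j) (F t))
    (ha : Summable fun j : ℕ => ‖a j‖ * (v.re + j) ^ (-s.re)) :
    HasSum (fun j : ℕ => Gamma s * (a j * (v + j) ^ (-s)))
      (mellin (fun t : ℝ => exp (-(v * t)) * F t) s) := by
  have hvj : ∀ j : ℕ, 0 < (v + j).re := fun j => by
    have : (0 : ℝ) ≤ j := j.cast_nonneg
    simp only [add_re, natCast_re]; linarith
  have key := hasSum_integral_of_summable_integral_norm (μ := volume.restrict (Ioi (0 : ℝ)))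
    (F := fun (j : ℕ) (t : ℝ) => a j * ((t : ℂ) ^ (s - 1) * exp (-((v + j) * t))))
    (fun j => (integrableOn_cpow_mul_exp_neg_mul hs (hvj j)).const_mul _) ?_
  · convert! key using 1
    · ext j
      rw [integral_const_mul, integral_cpow_mul_exp_neg_mul_complex hs (hvj j)]
      ring
    · rw [mellin]
      refine setIntegral_congr_fun measurableSet_Ioi fun t ht => ?_
      have h := ((hF t ht).mul_left ((t : ℂ) ^ (s - 1) * exp (-(v * t)))).tsum_eq
      simp only [smul_eq_mul]
      rw [← mul_assoc, ← h]
      refine tsum_congr fun j => ?_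
      rw [add_mul, neg_add, exp_add, ← exp_nat_mul]
      ring_nf
  -- The norms integrate to a Gamma integral in the real parts, whence the shape of `ha`.
  · have hint : ∀ j : ℕ, ∫ t : ℝ in Ioi 0, ‖a j * ((t : ℂ) ^ (s - 1) * exp (-((v + j) * t)))‖
        = Real.Gamma s.re * (‖a j‖ * (v.re + j) ^ (-s.re)) := by
      intro j
      have h1 : ∫ t : ℝ in Ioi 0, ‖a j * ((t : ℂ) ^ (s - 1) * exp (-((v + j) * t)))‖
          = ∫ t : ℝ in Ioi 0, ‖a j‖ * (t ^ (s.re - 1) * Real.exp (-((v + j).re * t))) := by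
        refine setIntegral_congr_fun measurableSet_Ioi fun t ht => ?_
        simp only [norm_mul (a j), norm_cpow_mul_exp_neg_mul ht]
      rw [h1, integral_const_mul, Real.integral_rpow_mul_exp_neg_mul_Ioi hs (hvj j), one_div,
        Real.inv_rpow (hvj j).le, ← Real.rpow_neg (hvj j).le]
      simp only [add_re, natCast_re]
      ring
    simp_rw [hint]
    exact ha.mul_left _

/-! ### Growth and summability of the terms. -/

theorem isTheta_norm_add_natCast (v : ℂ) :
    (fun j : ℕ => ‖v + j‖) =Θ[atTop] fun j : ℕ => (j : ℝ) := by
  have h : (fun j : ℕ => (j : ℂ) + v) ~[atTop] fun j : ℕ => (j : ℂ) := by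
    refine IsEquivalent.refl.add_isLittleO ?_
    rw [isLittleO_const_left]
    right
    simpa [Function.comp_def] using tendsto_natCast_atTop_atTop (R := ℝ)
  have h2 := h.isTheta.norm_left.norm_right
  simpa [add_comm] using h2

/-- The argument stays in `[-π, π]`, so the imaginary part of the exponent costs at most a factor
`e^{π|Im s|}`. -/
theorem isBigO_add_natCast_cpow (v s : ℂ) :
    (fun j : ℕ => (v + j) ^ s) =O[atTop] fun j : ℕ => (j : ℝ) ^ s.re := by
  have h := ((isTheta_norm_add_natCast v).rpow (r := s.re)
    (Eventually.of_forall fun j => norm_nonneg _)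
    (Eventually.of_forall fun j => j.cast_nonneg)).1
  refine IsBigO.trans (IsBigO.of_bound (Real.exp (Real.pi * |s.im|))
    (Eventually.of_forall fun j => ?_)) h
  refine (norm_cpow_le _ _).trans ?_
  rw [Real.norm_of_nonneg (by positivity), div_eq_mul_inv, ← Real.exp_neg, mul_comm]
  gcongr
  rw [← neg_mul]
  refine (le_abs_self _).trans ?_
  rw [abs_mul, abs_neg]
  gcongr
  exact abs_arg_le_pi _

theorem summable_natCast_rpow_mul_geometric {σ r : ℝ} (hr : 0 ≤ r)
    (h : r < 1 ∨ r ≤ 1 ∧ 1 < σ) : Summable fun j : ℕ => (j : ℝ) ^ (-σ) * r ^ j := by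
  rcases h with h | ⟨h, hσ⟩
  · obtain ⟨n, hn⟩ := exists_nat_ge (-σ)
    refine Summable.of_norm_bounded_eventually_nat
      (summable_pow_mul_geometric_of_norm_lt_one n (by rwa [Real.norm_of_nonneg hr])) ?_
    filter_upwards [eventually_ge_atTop 1] with j hj
    have hj' : (1 : ℝ) ≤ j := by exact_mod_cast hj
    rw [Real.norm_of_nonneg (by positivity), ← Real.rpow_natCast (j : ℝ) n]
    gcongr
  · refine Summable.of_nonneg_of_le (fun j => by positivity) (fun j => ?_)
      (Real.summable_nat_rpow.2 (by linarith : -σ < -1))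
    exact mul_le_of_le_one_right (by positivity) (pow_le_one₀ hr h)

theorem summable_norm_lerchSeries {z s : ℂ} (v : ℂ) (h : ‖z‖ < 1 ∨ ‖z‖ ≤ 1 ∧ 1 < s.re) :
    Summable fun j : ℕ => ‖(v + j) ^ (-s) * z ^ j‖ := by
  refine summable_of_isBigO_nat
    (summable_natCast_rpow_mul_geometric (σ := s.re) (norm_nonneg z) h) ?_
  refine IsBigO.norm_left ((isBigO_add_natCast_cpow v (-s)).mul
    (IsBigO.of_bound 1 (Eventually.of_forall fun j => ?_)))
  simp

/-- The summability needed to integrate `∑ (v+j)^N (z e^(-t))^j` against `t^(s+N-1) e^(-vt)`. -/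
theorem summable_norm_pow_mul_rpow {v : ℂ} {σ : ℝ} (hv : 0 < v.re) (N : ℕ) {z : ℂ}
    (h : ‖z‖ < 1 ∨ ‖z‖ ≤ 1 ∧ 1 < σ) :
    Summable fun j : ℕ => ‖(v + j) ^ N * z ^ j‖ * (v.re + j) ^ (-(σ + N)) := by
  refine summable_of_isBigO_nat
    (summable_natCast_rpow_mul_geometric (σ := σ) (norm_nonneg z) h) ?_
  have h1 : (fun j : ℕ => ‖v + j‖ ^ N) =O[atTop] fun j : ℕ => (j : ℝ) ^ N :=
    (isTheta_norm_add_natCast v).1.pow N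
  have h2 : (fun j : ℕ => (v.re + j) ^ (-(σ + N))) =O[atTop]
      fun j : ℕ => (j : ℝ) ^ (-(σ + N)) := by
    refine (IsTheta.rpow (Eventually.of_forall fun j => by positivity)
      (Eventually.of_forall fun j => by positivity) ?_).1
    convert isTheta_norm_add_natCast v.re using 2 with j
    rw [← ofReal_natCast, ← ofReal_add, Complex.norm_of_nonneg (by positivity)]
  refine ((h1.mul h2).mul (isBigO_refl (fun j : ℕ => ‖z‖ ^ j) atTop)).congr' ?_ ?_
  · exact Eventually.of_forall fun j => by simp only [norm_mul, norm_pow]; ring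
  · filter_upwards [eventually_gt_atTop 0] with j hj
    have hj' : (0 : ℝ) < j := by exact_mod_cast hj
    rw [← Real.rpow_natCast (j : ℝ) N, ← Real.rpow_add hj']
    ring_nf

/-! ### The rational functions at `s = 0, -1, -2, …`. -/

/-- The rational function `(v + w d/dw)^N (1 - w)⁻¹`, which sums `∑ (v + j)^N w^j`. -/
noncomputable def lerchRational (v : ℂ) : ℕ → ℂ → ℂ
  | 0 => fun w => (1 - w)⁻¹
  | N + 1 => fun w => v * lerchRational v N w + w * deriv (lerchRational v N) w

theorem differentiableOn_lerchRational (v : ℂ) (N : ℕ) :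
    DifferentiableOn ℂ (lerchRational v N) {(1 : ℂ)}ᶜ := by
  induction N with
  | zero =>
    intro w hw
    have : 1 - w ≠ 0 := sub_ne_zero.2 (Ne.symm hw)
    exact (((differentiableAt_const _).sub differentiableAt_id).inv this).differentiableWithinAt
  | succ N ih =>
    exact (ih.const_mul v).add (differentiableOn_id.mul (ih.deriv isOpen_compl_singleton))

theorem hasSum_lerchRational (v : ℂ) (N : ℕ) {w : ℂ} (hw : ‖w‖ < 1) :
    HasSum (fun j : ℕ => (v + j) ^ N * w ^ j) (lerchRational v N w) := by
  induction N generalizing w with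
  | zero => simpa [lerchRational] using hasSum_geometric_of_norm_lt_one hw
  | succ N ih =>
    -- Termwise differentiation needs a summable bound that is uniform on a disc around `0`
    -- containing `w`.
    obtain ⟨r, hwr, hr⟩ := exists_between hw
    have hr0 : 0 ≤ r := (norm_nonneg w).trans hwr.le
    have hsum : Summable fun j : ℕ => ‖v + j‖ ^ N * r ^ j := by
      have := summable_norm_lerchSeries (z := r) (s := -(N : ℂ)) v
        (Or.inl (by simpa [abs_of_nonneg hr0] using hr))
      simpa [abs_of_nonneg hr0] using this
    have hd := hasSum_deriv_of_summable_norm (U := Metric.ball (0 : ℂ) r) (z := w)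
      (F := fun (j : ℕ) w => (v + j) ^ N * w ^ j) hsum (fun j => by fun_prop) Metric.isOpen_ball
      (fun j x hx => by
        rw [mem_ball_zero_iff] at hx
        rw [norm_mul, norm_pow, norm_pow]
        gcongr) (by simpa using hwr)
    have heq : (fun w => ∑' j : ℕ, (v + j) ^ N * w ^ j) =ᶠ[𝓝 w] lerchRational v N := by
      filter_upwards [Metric.isOpen_ball.mem_nhds (show w ∈ Metric.ball (0 : ℂ) 1 by simpa using hw)]
        with x hx
      exact (ih (by simpa using hx)).tsum_eq
    rw [heq.deriv_eq] at hd
    have hadd := ((ih hw).mul_left v).add (hd.mul_left w)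
    refine hadd.congr_fun fun j => ?_
    rw [deriv_const_mul_field, deriv_pow_field]
    rcases j with _ | j
    · simp [pow_succ, mul_comm]
    · simp only [Nat.add_sub_cancel, pow_succ]; ring

/-! ### The cut plane and uniqueness of the continuation in `z`. -/

theorem isOpen_lerchCutPlane : IsOpen lerchCutPlane :=
  isOpen_slitPlane.preimage (continuous_const.sub continuous_id)

/-- The map `z ↦ 1 - z` turns star-convexity of the slit plane about `1` into star-convexity about
`0`. This gives connectedness, and keeps `z e^{-t}` off the cut in the Mellin integral. -/
theorem ofReal_mul_mem_lerchCutPlane {z : ℂ} (hz : z ∈ lerchCutPlane) {r : ℝ} (h0 : 0 ≤ r)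
    (h1 : r ≤ 1) : (r : ℂ) * z ∈ lerchCutPlane := by
  have h := starConvex_one_slitPlane hz (sub_nonneg.2 h1) h0 (by ring)
  have h' : (1 - r) • (1 : ℂ) + r • (1 - z) = 1 - r * z := by
    simp only [real_smul, ofReal_sub, ofReal_one]; ring
  rw [h'] at h
  exact h

theorem isPreconnected_lerchCutPlane : IsPreconnected lerchCutPlane := by
  have h : StarConvex ℝ (0 : ℂ) lerchCutPlane := by
    rw [starConvex_zero_iff]
    intro z hz r h0 h1
    rw [real_smul]
    exact ofReal_mul_mem_lerchCutPlane hz h0 h1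
  exact (h.isPathConnected (by simp [lerchCutPlane])).isConnected.isPreconnected

theorem mem_lerchCutPlane_of_norm_lt_one {z : ℂ} (hz : ‖z‖ < 1) : z ∈ lerchCutPlane := by
  have := mem_slitPlane_of_norm_lt_one (z := -z) (by simpa using hz)
  rwa [← sub_eq_add_neg] at this

theorem ne_one_of_mem_lerchCutPlane {z : ℂ} (hz : z ∈ lerchCutPlane) : z ≠ 1 := by
  rintro rfl
  simp [lerchCutPlane] at hz

theorem mem_lerchCutPlane_of_im_ne_zero {z : ℂ} (hz : z.im ≠ 0) : z ∈ lerchCutPlane := by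
  right; simpa using hz

/-- Points of the cut are approached vertically. Thus the filter in the definition of `Φ` is
nontrivial everywhere and its limits are unique. -/
theorem mem_closure_lerchCutPlane (z : ℂ) : z ∈ closure lerchCutPlane := by
  by_cases hz : z.im = 0
  · have htend : Tendsto (fun n : ℕ => z + ((1 / ((n : ℝ) + 1) : ℝ) : ℂ) * I) atTop (𝓝 z) := by
      have h := (continuous_ofReal.tendsto _).comp
        (tendsto_one_div_add_atTop_nhds_zero_nat (𝕜 := ℝ))
      have h2 := (h.mul_const I).const_add z
      rwa [ofReal_zero, zero_mul, add_zero] at h2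
    refine mem_closure_of_tendsto htend (Eventually.of_forall fun n =>
      mem_lerchCutPlane_of_im_ne_zero ?_)
    rw [add_im, hz, im_ofReal_mul]
    simp only [I_im, mul_one, zero_add]
    positivity
  · exact subset_closure (mem_lerchCutPlane_of_im_ne_zero hz)

theorem IsLerchContinuation.eqOn {s v : ℂ} {f g : ℂ → ℂ} (hf : IsLerchContinuation s v f)
    (hg : IsLerchContinuation s v g) : EqOn f g lerchCutPlane := by
  refine (hf.1.analyticOnNhd isOpen_lerchCutPlane).eqOn_of_preconnected_of_eventuallyEq
    (hg.1.analyticOnNhd isOpen_lerchCutPlane) isPreconnected_lerchCutPlane (z₀ := 0)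
    (mem_lerchCutPlane_of_norm_lt_one (by simp)) ?_
  filter_upwards [Metric.ball_mem_nhds (0 : ℂ) one_pos] with z hz
  rw [mem_ball_zero_iff] at hz
  rw [hf.2 z hz, hg.2 z hz]

/-- The value of `Φ` off `z = 1` is read off from any continuation that is continuous at `z`. -/
theorem IsLerchContinuation.hurwitzLerchPhi_eq {s v z : ℂ} {f : ℂ → ℂ}
    (hf : IsLerchContinuation s v f) (hz : z ≠ 1) (hc : ContinuousAt f z) :
    hurwitzLerchPhi z s v = f z := by
  have hε : IsLerchContinuation s v (Classical.epsilon (IsLerchContinuation s v)) :=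
    Classical.epsilon_spec ⟨f, hf⟩
  have : (𝓝[lerchCutPlane] z).NeBot := mem_closure_iff_nhdsWithin_neBot.1 (mem_closure_lerchCutPlane z)
  rw [hurwitzLerchPhi, if_neg hz]
  refine Tendsto.limUnder_eq ((hc.continuousWithinAt (s := lerchCutPlane)).tendsto.congr' ?_)
  filter_upwards [self_mem_nhdsWithin] with w hw using hf.eqOn hε hw

theorem IsLerchContinuation.hurwitzLerchPhi_eq_of_mem {s v z : ℂ} {f : ℂ → ℂ}
    (hf : IsLerchContinuation s v f) (hz : z ∈ lerchCutPlane) : hurwitzLerchPhi z s v = f z :=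
  hf.hurwitzLerchPhi_eq (ne_one_of_mem_lerchCutPlane hz)
    (hf.1.continuousOn.continuousAt (isOpen_lerchCutPlane.mem_nhds hz))

theorem isLerchContinuation_lerchRational (v : ℂ) (N : ℕ) :
    IsLerchContinuation (-(N : ℂ)) v (lerchRational v N) := by
  refine ⟨(differentiableOn_lerchRational v N).mono fun z hz => ne_one_of_mem_lerchCutPlane hz,
    fun z hz => ?_⟩
  rw [lerchSeries, ← (hasSum_lerchRational v N hz).tsum_eq]
  simp

/-- The rational continuation is singular at most at `1`, hence continuous across the rest of the
cut. -/
theorem hurwitzLerchPhi_neg_natCast (v : ℂ) (N : ℕ) {z : ℂ} (hz : z ≠ 1) :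
    hurwitzLerchPhi z (-(N : ℂ)) v = lerchRational v N z :=
  (isLerchContinuation_lerchRational v N).hurwitzLerchPhi_eq hz
    ((differentiableOn_lerchRational v N).continuousOn.continuousAt
      (isOpen_compl_singleton.mem_nhds hz))

/-! ### Existence of the continuation in `z`, and holomorphy in `s` off the cut. -/

theorem exists_lerchRational_bound (v : ℂ) (N : ℕ) {z₀ : ℂ} (hz₀ : z₀ ∈ lerchCutPlane) :
    ∃ V ∈ 𝓝 z₀, ∃ C : ℝ, 0 ≤ C ∧ ∀ z ∈ V, ∀ t : ℝ, 0 ≤ t →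
      ‖lerchRational v N (z * exp (-t))‖ ≤ C := by
  obtain ⟨ε, hε, hsub⟩ := Metric.nhds_basis_closedBall.mem_iff.1
    (isOpen_lerchCutPlane.mem_nhds hz₀)
  -- Since `e^{-t}` lies in `(0, 1]`, all the points `z e^{-t}` lie on segments from `0` to a small
  -- closed ball, and these segments fill a compact subset of the cut plane.
  have hK : IsCompact ((fun p : ℝ × ℂ => (p.1 : ℂ) * p.2) ''
      (Icc (0 : ℝ) 1 ×ˢ Metric.closedBall z₀ ε)) :=
    (isCompact_Icc.prod (isCompact_closedBall z₀ ε)).image (by fun_prop)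
  obtain ⟨C, hC⟩ := hK.exists_bound_of_continuousOn (f := lerchRational v N) <| by
    refine (differentiableOn_lerchRational v N).continuousOn.mono ?_
    rintro _ ⟨⟨r, w⟩, ⟨hr, hw⟩, rfl⟩
    exact ne_one_of_mem_lerchCutPlane (ofReal_mul_mem_lerchCutPlane (hsub hw) hr.1 hr.2)
  refine ⟨_, Metric.closedBall_mem_nhds z₀ hε, max C 0, le_max_right _ _, fun z hz t ht => ?_⟩
  refine (hC _ ⟨⟨Real.exp (-t), z⟩, ⟨⟨(Real.exp_pos _).le, ?_⟩, hz⟩, ?_⟩).trans (le_max_left _ _)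
  · simpa using ht
  · simp [mul_comm]

theorem mul_exp_neg_mem_lerchCutPlane {z : ℂ} (hz : z ∈ lerchCutPlane) {t : ℝ} (ht : 0 ≤ t) :
    z * exp (-t) ∈ lerchCutPlane := by
  have := ofReal_mul_mem_lerchCutPlane hz (r := Real.exp (-t)) (Real.exp_pos _).le (by simpa using ht)
  rwa [mul_comm, ofReal_exp, ofReal_neg] at this

theorem continuousOn_exp_mul_lerchRational (v : ℂ) (N : ℕ) {z : ℂ} (hz : z ∈ lerchCutPlane) :
    ContinuousOn (fun t : ℝ => exp (-(v * t)) * lerchRational v N (z * exp (-t))) (Ioi 0) := by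
  refine ContinuousOn.mul (by fun_prop) ?_
  refine (differentiableOn_lerchRational v N).continuousOn.comp (by fun_prop) fun t ht => ?_
  exact ne_one_of_mem_lerchCutPlane (mul_exp_neg_mem_lerchCutPlane hz (le_of_lt ht))

/-- The integral `Γ(s+N)⁻¹ ∫ t^(s+N-1) e^(-vt) R_N(z e^(-t)) dt` which represents `Φ(z, s, v)` for
`Re v > 0` and `Re s > -N`, where `R_N` sums `∑ (v + j)^N w^j`. -/
noncomputable def lerchIntegral (v : ℂ) (N : ℕ) (z s : ℂ) : ℂ :=
  (Gamma (s + N))⁻¹ *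
    mellin (fun t : ℝ => exp (-(v * t)) * lerchRational v N (z * exp (-t))) (s + N)

theorem differentiableOn_lerchIntegral {v s : ℂ} {N : ℕ} (hv : 0 < v.re) (hs : 0 < (s + N).re) :
    DifferentiableOn ℂ (fun z => lerchIntegral v N z s) lerchCutPlane := by
  refine DifferentiableOn.const_mul ?_ _
  simp only [mellin, smul_eq_mul]
  refine differentiableOn_integral_of_locally_dominated isOpen_lerchCutPlane ?_ ?_ ?_
  · intro z hz
    refine ContinuousOn.aestronglyMeasurable ?_ measurableSet_Ioi
    refine ContinuousOn.mul (fun t ht => ?_) (continuousOn_exp_mul_lerchRational v N hz)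
    exact (continuousAt_ofReal_cpow_const t _ (Or.inr (ne_of_gt ht))).continuousWithinAt
  · filter_upwards [ae_restrict_mem measurableSet_Ioi] with t ht
    refine DifferentiableOn.const_mul (DifferentiableOn.const_mul ?_ _) _
    refine (differentiableOn_lerchRational v N).comp (by fun_prop) fun z hz => ?_
    exact ne_one_of_mem_lerchCutPlane (mul_exp_neg_mem_lerchCutPlane hz (le_of_lt ht))
  · intro z₀ hz₀
    obtain ⟨V, hV, C, hC, hbound⟩ := exists_lerchRational_bound v N hz₀
    refine ⟨V, hV, _, (integrableOn_rpow_mul_exp_neg_mul hs hv).mul_const C, ?_⟩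
    filter_upwards [ae_restrict_mem measurableSet_Ioi] with t ht z hz
    rw [← mul_assoc, norm_mul, norm_cpow_mul_exp_neg_mul ht]
    have ht' : (0 : ℝ) < t := ht
    gcongr
    exact hbound z hz t ht'.le

theorem differentiableAt_lerchIntegral {v z s : ℂ} {N : ℕ} (hv : 0 < v.re)
    (hz : z ∈ lerchCutPlane) (hs : 0 < (s + N).re) :
    DifferentiableAt ℂ (lerchIntegral v N z) s := by
  obtain ⟨V, hV, C, hC, hbound⟩ := exists_lerchRational_bound v N hz
  have hnorm : ∀ t : ℝ, 0 ≤ t → ‖exp (-(v * t)) * lerchRational v N (z * exp (-t))‖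
      ≤ C * Real.exp (-v.re * t) := fun t ht => by
    rw [norm_mul, norm_exp, mul_comm]
    have : (-(v * t)).re = -v.re * t := by simp
    rw [this]
    gcongr
    exact hbound z (mem_of_mem_nhds hV) t ht
  refine DifferentiableAt.mul (differentiable_one_div_Gamma.differentiableAt.comp s
    (by fun_prop)) (DifferentiableAt.comp (g := mellin _) s ?_ (by fun_prop))
  -- The integrand without its power of `t` is bounded near `0`, so `b = 0` and the strip of
  -- convergence is `Re (s + N) > 0`.
  refine mellin_differentiableAt_of_isBigO_rpow_exp hv
    ((continuousOn_exp_mul_lerchRational v N hz).locallyIntegrableOn measurableSet_Ioi)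
    (b := 0) ?_ ?_ hs
  · refine IsBigO.of_bound C ?_
    filter_upwards [eventually_ge_atTop 0] with t ht
    rw [Real.norm_of_nonneg (Real.exp_pos _).le]
    exact hnorm t ht
  · refine IsBigO.of_bound C ?_
    filter_upwards [self_mem_nhdsWithin] with t ht
    have ht' : (0 : ℝ) < t := ht
    refine (hnorm t ht'.le).trans ?_
    simp only [neg_zero, Real.rpow_zero, norm_one]
    gcongr
    rw [Real.exp_le_one_iff]
    nlinarith

/-- Integrating termwise against `t^{s+N-1}` produces `(v + j)^{-(s+N)}`, and the coefficient `(v +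
j)^N` of the rational function restores the exponent `-s`. -/
theorem lerchIntegral_eq_lerchSeries {v z s : ℂ} {N : ℕ} (hv : 0 < v.re) (hz : ‖z‖ < 1)
    (hs : 0 < (s + N).re) : lerchIntegral v N z s = lerchSeries z s v := by
  have h := hasSum_mellin_exp_neg_mul (s := s + N) (v := v) hs hv
    (a := fun j => (v + j) ^ N * z ^ j) (F := fun t => lerchRational v N (z * exp (-t))) ?_ ?_
  · rw [lerchIntegral, ← h.tsum_eq, tsum_mul_left, ← mul_assoc,
      inv_mul_cancel₀ (Gamma_ne_zero_of_re_pos hs), one_mul, lerchSeries]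
    refine tsum_congr fun j => ?_
    have hvj : v + j ≠ 0 := fun h0 => by
      have := congrArg re h0
      simp only [add_re, natCast_re, zero_re] at this
      have : (0 : ℝ) ≤ j := j.cast_nonneg
      linarith
    rw [neg_add, cpow_add _ _ hvj, cpow_neg _ (N : ℂ), cpow_natCast]
    field_simp
  · intro t ht
    have hle : ‖z * exp (-t)‖ < 1 := by
      rw [norm_mul, norm_exp]
      refine (mul_le_of_le_one_right (norm_nonneg z) ?_).trans_lt hz
      simpa using ht.le
    refine (hasSum_lerchRational v N hle).congr_fun fun j => ?_
    rw [mul_pow, mul_assoc]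
  · simpa using summable_norm_pow_mul_rpow (σ := s.re) hv N (Or.inl hz)

/-- A number of initial terms of the Lerch series whose removal makes the shifted parameter lie in
the right half-plane. -/
noncomputable def lerchShift (v : ℂ) : ℕ := ⌈|v.re|⌉₊ + 1

theorem re_add_lerchShift_pos (v : ℂ) : 0 < (v + lerchShift v).re := by
  have := Nat.le_ceil |v.re|
  have := neg_abs_le v.re
  simp only [lerchShift, add_re, natCast_re, Nat.cast_add, Nat.cast_one, one_re]
  linarith

theorem lerchSeries_eq_sum_add {z s : ℂ} (v : ℂ) (h : ‖z‖ < 1 ∨ ‖z‖ ≤ 1 ∧ 1 < s.re) (M : ℕ) :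
    lerchSeries z s v = ∑ j ∈ Finset.range M, (v + j) ^ (-s) * z ^ j
      + z ^ M * lerchSeries z s (v + M) := by
  rw [lerchSeries, ← (summable_norm_lerchSeries v h).of_norm.sum_add_tsum_nat_add M, lerchSeries,
    ← tsum_mul_left]
  congr 1
  refine tsum_congr fun j => ?_
  push_cast
  rw [pow_add]
  ring_nf

/-- The continuation of the Lerch series for arbitrary `v`, valid for `Re s > -N`. -/
noncomputable def lerchContinuation (v : ℂ) (N : ℕ) (z s : ℂ) : ℂ :=
  ∑ j ∈ Finset.range (lerchShift v), (v + j) ^ (-s) * z ^ j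
    + z ^ lerchShift v * lerchIntegral (v + lerchShift v) N z s

theorem isLerchContinuation_lerchContinuation (v : ℂ) {s : ℂ} {N : ℕ} (hs : 0 < (s + N).re) :
    IsLerchContinuation s v (fun z => lerchContinuation v N z s) := by
  refine ⟨DifferentiableOn.add (by fun_prop) (DifferentiableOn.mul (by fun_prop)
    (differentiableOn_lerchIntegral (re_add_lerchShift_pos v) hs)), fun z hz => ?_⟩
  simp only [lerchContinuation]
  rw [lerchIntegral_eq_lerchSeries (re_add_lerchShift_pos v) hz hs,
    ← lerchSeries_eq_sum_add v (Or.inl hz)]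

theorem exists_nat_re_add_pos (s : ℂ) : ∃ N : ℕ, 0 < (s + N).re := by
  obtain ⟨N, hN⟩ := exists_nat_gt (-s.re)
  exact ⟨N, by simp only [add_re, natCast_re]; linarith⟩

theorem hurwitzLerchPhi_eq_lerchContinuation {v z s : ℂ} {N : ℕ} (hz : z ∈ lerchCutPlane)
    (hs : 0 < (s + N).re) : hurwitzLerchPhi z s v = lerchContinuation v N z s :=
  (isLerchContinuation_lerchContinuation v hs).hurwitzLerchPhi_eq_of_mem hz

theorem isLerchContinuation_hurwitzLerchPhi (s v : ℂ) :
    IsLerchContinuation s v (fun z => hurwitzLerchPhi z s v) := by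
  obtain ⟨N, hN⟩ := exists_nat_re_add_pos s
  have h := isLerchContinuation_lerchContinuation v hN
  refine ⟨h.1.congr fun z hz => hurwitzLerchPhi_eq_lerchContinuation hz hN, fun z hz => ?_⟩
  exact (hurwitzLerchPhi_eq_lerchContinuation (mem_lerchCutPlane_of_norm_lt_one hz) hN).trans
    (h.2 z hz)

/-- Off the cut, `Φ` is entire in `s`. -/
theorem differentiable_hurwitzLerchPhi {v z : ℂ} (hv : ∀ j : ℕ, v ≠ -(j : ℂ))
    (hz : z ∈ lerchCutPlane) : Differentiable ℂ fun s => hurwitzLerchPhi z s v := by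
  intro s
  obtain ⟨N, hN⟩ := exists_nat_re_add_pos s
  have hopen : IsOpen {s : ℂ | 0 < (s + N).re} :=
    isOpen_lt continuous_const (continuous_re.comp (continuous_id.add continuous_const))
  have heq : (fun s => hurwitzLerchPhi z s v) =ᶠ[𝓝 s] lerchContinuation v N z := by
    filter_upwards [hopen.mem_nhds hN] with w hw
    exact hurwitzLerchPhi_eq_lerchContinuation hz hw
  refine DifferentiableAt.congr_of_eventuallyEq ?_ heq
  refine DifferentiableAt.add (DifferentiableAt.fun_sum fun j _ => ?_)
    ((differentiableAt_lerchIntegral (re_add_lerchShift_pos v) hz hN).const_mul _)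
  refine DifferentiableAt.mul_const (differentiableAt_id.neg.const_cpow (Or.inl ?_)) _
  exact fun h0 => hv j (eq_neg_of_add_eq_zero_left h0)

/-- On the closed unit disc and off the cut, `Φ` is the sum of its series for `Re s > 1`. -/
theorem hurwitzLerchPhi_eq_lerchSeries_of_norm_le_one {z s : ℂ} (v : ℂ) (hz : z ∈ lerchCutPlane)
    (hz1 : ‖z‖ ≤ 1) (hs : 1 < s.re) : hurwitzLerchPhi z s v = lerchSeries z s v := by
  have hΦ := isLerchContinuation_hurwitzLerchPhi s v
  have : (𝓝[Metric.ball (0 : ℂ) 1] z).NeBot := by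
    rw [← mem_closure_iff_nhdsWithin_neBot, closure_ball _ one_ne_zero]
    simpa using hz1
  have h1 : Tendsto (fun w => hurwitzLerchPhi w s v) (𝓝[Metric.ball 0 1] z)
      (𝓝 (hurwitzLerchPhi z s v)) :=
    (hΦ.1.continuousOn.continuousAt (isOpen_lerchCutPlane.mem_nhds hz)).tendsto.mono_left
      nhdsWithin_le_nhds
  have h2 : Tendsto (fun w => lerchSeries w s v) (𝓝[Metric.ball 0 1] z)
      (𝓝 (lerchSeries z s v)) := by
    -- For `Re s > 1` the terms at `z = 1` dominate those on the whole unit disc.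
    refine tendsto_tsum_of_dominated_convergence
      (bound := fun j : ℕ => ‖(v + j) ^ (-s) * (1 : ℂ) ^ j‖)
      (summable_norm_lerchSeries v (Or.inr ⟨by simp, hs⟩)) (fun j => ?_) ?_
    · have : Continuous fun w : ℂ => (v + j) ^ (-s) * w ^ j := by fun_prop
      exact this.continuousAt.tendsto.mono_left nhdsWithin_le_nhds
    · filter_upwards [self_mem_nhdsWithin] with w hw j
      rw [mem_ball_zero_iff] at hw
      rw [norm_mul, norm_mul, norm_pow, norm_pow, norm_one]
      gcongr
  refine tendsto_nhds_unique (h1.congr' ?_) h2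
  filter_upwards [self_mem_nhdsWithin] with w hw
  exact hΦ.2 w (by simpa using hw)

/-! ### The Hurwitz zeta function: continuation in `s` at `z = 1`. -/

/-- Functions on the half-planes `Re s > 1 - K` that agree for `Re s > 1` glue to an entire
function. -/
theorem exists_entire_of_halfPlanes {h : ℂ → ℂ} {G : ℕ → ℂ → ℂ}
    (hG : ∀ K : ℕ, DifferentiableOn ℂ (G K) {s : ℂ | 1 - (K : ℝ) < s.re})
    (heq : ∀ (K : ℕ) (s : ℂ), 1 < s.re → G K s = h s) :
    ∃ g : ℂ → ℂ, Differentiable ℂ g ∧ ∀ s : ℂ, 1 < s.re → g s = h s := by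
  have hopen : ∀ x : ℝ, IsOpen {s : ℂ | x < s.re} := fun x =>
    isOpen_lt continuous_const continuous_re
  have hmono : ∀ {K L : ℕ}, K ≤ L →
      {s : ℂ | 1 - (K : ℝ) < s.re} ⊆ {s : ℂ | 1 - (L : ℝ) < s.re} := by
    intro K L hKL s hs
    have : (K : ℝ) ≤ L := by exact_mod_cast hKL
    rw [mem_ofPred_eq] at hs ⊢
    linarith
  have hle : ∀ {K L : ℕ}, K ≤ L → EqOn (G K) (G L) {s : ℂ | 1 - (K : ℝ) < s.re} := by
    intro K L hKL
    refine ((hG K).analyticOnNhd (hopen _)).eqOn_of_preconnected_of_eventuallyEq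
      (((hG L).mono (hmono hKL)).analyticOnNhd (hopen _))
      (convex_halfSpace_re_gt _).isPreconnected (z₀ := 2) ?_ ?_
    · have : (0 : ℝ) ≤ K := K.cast_nonneg
      simp only [mem_ofPred_eq, re_ofNat]
      linarith
    · filter_upwards [(hopen 1).mem_nhds (show (1 : ℝ) < (2 : ℂ).re by norm_num)] with s hs
      rw [heq K s hs, heq L s hs]
  have hag : ∀ {K L : ℕ} {s : ℂ}, 1 - (K : ℝ) < s.re → 1 - (L : ℝ) < s.re → G K s = G L s := by
    intro K L s hK hL
    rcases le_total K L with h | h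
    · exact hle h hK
    · exact (hle h hL).symm
  have hex : ∀ s : ℂ, ∃ K : ℕ, 1 - (K : ℝ) < s.re := fun s => by
    obtain ⟨K, hK⟩ := exists_nat_gt (1 - s.re)
    exact ⟨K, by linarith⟩
  choose κ hκ using hex
  refine ⟨fun s => G (κ s) s, fun s => ?_, fun s hs => heq _ s hs⟩
  refine (((hG (κ s)) s (hκ s)).differentiableAt ((hopen _).mem_nhds (hκ s))).congr_of_eventuallyEq
    ?_
  filter_upwards [(hopen _).mem_nhds (hκ s)] with w hw
  exact hag (hκ w) hw

theorem Gamma_add_natCast_eq_prod {x : ℂ} (hx : 0 < x.re) (k : ℕ) :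
    Gamma (x + k) = (∏ i ∈ Finset.range k, (x + i)) * Gamma x := by
  induction k with
  | zero => simp
  | succ k ih =>
    have hne : x + k ≠ 0 := fun h0 => by
      have := congrArg re h0
      simp only [add_re, natCast_re, zero_re] at this
      have : (0 : ℝ) ≤ k := k.cast_nonneg
      linarith
    rw [Nat.cast_succ, ← add_assoc, Gamma_add_one _ hne, ih, Finset.prod_range_succ]
    ring

/-- The expansion of `(1 - e^(-t))⁻¹` in powers of `t`, starting with `t⁻¹`, to all orders. -/
theorem exists_isBigO_inv_one_sub_exp_neg :
    ∃ c : ℕ → ℂ, ∀ K : ℕ,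
      (fun t : ℝ => (1 - exp (-t))⁻¹ - ∑ k ∈ Finset.range K, c k * (t : ℂ) ^ ((k : ℂ) - 1))
        =O[𝓝[>] 0] fun t : ℝ => t ^ (-(1 - (K : ℝ))) := by
  -- `E(t) = (1 - e^{-t})/t` is entire with `E(0) = 1`, so `1/E` has a power series at `0`; dividing
  -- it by `t` gives the expansion.
  set E : ℂ → ℂ := dslope (fun t => 1 - exp (-t)) 0 with hE
  have hE0 : E 0 = 1 := by
    rw [hE, dslope_same]
    have : HasDerivAt (fun t : ℂ => 1 - exp (-t)) (-(exp (-0) * -1)) 0 :=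
      ((hasDerivAt_neg (0 : ℂ)).cexp).const_sub 1
    rw [this.deriv]
    simp
  have hEd : Differentiable ℂ E := by
    rw [← differentiableOn_univ, hE, differentiableOn_dslope univ_mem]
    fun_prop
  obtain ⟨p, hp⟩ := ((hEd.analyticAt 0).inv (by rw [hE0]; exact one_ne_zero))
  refine ⟨p.coeff, fun K => ?_⟩
  have h1 := hp.isBigO_sub_partialSum_pow K
  have hof : Tendsto (fun t : ℝ => (t : ℂ)) (𝓝[>] 0) (𝓝 0) := by
    have := continuous_ofReal.tendsto 0
    rw [ofReal_zero] at this
    exact this.mono_left nhdsWithin_le_nhds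
  have h2 := (h1.comp_tendsto hof).mul
    (isBigO_refl (fun t : ℝ => (t : ℂ)⁻¹) (𝓝[>] 0)).norm_right
  refine h2.congr' ?_ ?_
  · filter_upwards [self_mem_nhdsWithin] with t ht
    have ht0 : (t : ℂ) ≠ 0 := ofReal_ne_zero.2 (ne_of_gt ht)
    simp only [Function.comp_apply, zero_add, Pi.inv_apply, FormalMultilinearSeries.partialSum,
      FormalMultilinearSeries.apply_eq_pow_smul_coeff, smul_eq_mul]
    rw [sub_mul, Finset.sum_mul, hE, dslope_of_ne _ ht0, slope_def_field]
    congr 1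
    · simp only [neg_zero, exp_zero, sub_self, sub_zero, inv_div]
      field_simp
    · refine Finset.sum_congr rfl fun k _ => ?_
      rw [cpow_sub _ _ ht0, cpow_natCast, cpow_one]
      ring
  · filter_upwards [self_mem_nhdsWithin] with t ht
    have ht0 : (0 : ℝ) < t := ht
    simp only [Function.comp_apply, norm_inv, norm_real, Real.norm_of_nonneg ht0.le]
    rw [neg_sub, Real.rpow_sub ht0, Real.rpow_natCast, Real.rpow_one, div_eq_mul_inv]

theorem one_sub_exp_neg_ne_zero {t : ℝ} (ht : 0 < t) : 1 - exp (-(t : ℂ)) ≠ 0 := by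
  rw [← ofReal_neg, ← ofReal_exp, ← ofReal_one, ← ofReal_sub, ofReal_ne_zero]
  have : Real.exp (-t) < 1 := by simpa using ht
  linarith

/-- `e^(-vt)` times the remainder of `(1 - e^(-t))⁻¹` after subtracting `K` terms. -/
noncomputable def hurwitzRemainder (c : ℕ → ℂ) (v : ℂ) (K : ℕ) (t : ℝ) : ℂ :=
  exp (-(v * t)) *
    ((1 - exp (-t))⁻¹ - ∑ k ∈ Finset.range K, c k * (t : ℂ) ^ ((k : ℂ) - 1))

theorem continuousOn_hurwitzRemainder (c : ℕ → ℂ) (v : ℂ) (K : ℕ) :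
    ContinuousOn (hurwitzRemainder c v K) (Ioi 0) := by
  refine ContinuousOn.mul (by fun_prop) (ContinuousOn.sub (ContinuousOn.inv₀ (by fun_prop)
    fun t ht => one_sub_exp_neg_ne_zero ht) (continuousOn_finsetSum _ fun k _ => ?_))
  refine ContinuousOn.mul continuousOn_const fun t ht => ?_
  exact (continuousAt_ofReal_cpow_const t _ (Or.inr (ne_of_gt ht))).continuousWithinAt

theorem hurwitzRemainder_isBigO_atTop (c : ℕ → ℂ) {v : ℂ} (hv : 0 < v.re) (K : ℕ) :
    hurwitzRemainder c v K =O[atTop] fun t : ℝ => Real.exp (-(v.re / 2) * t) := by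
  have h1 : (fun t : ℝ => exp (-(v * t))) =O[atTop] fun t : ℝ => Real.exp (-v.re * t) :=
    IsBigO.of_bound 1 (Eventually.of_forall fun t => by simp [norm_exp])
  have hexp : ∀ a : ℝ, (fun t : ℝ => t ^ a) =O[atTop] fun t : ℝ => Real.exp (v.re / 2 * t) :=
    fun a => (isLittleO_rpow_exp_pos_mul_atTop a (half_pos hv)).isBigO
  have h2 : (fun t : ℝ => (1 - exp (-t))⁻¹ - ∑ k ∈ Finset.range K, c k * (t : ℂ) ^ ((k : ℂ) - 1))
      =O[atTop] fun t : ℝ => Real.exp (v.re / 2 * t) := by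
    refine IsBigO.sub ?_ (IsBigO.fun_sum fun k _ => IsBigO.const_mul_left ?_ _)
    · have htend : Tendsto (fun t : ℝ => (1 - exp (-(t : ℂ)))⁻¹) atTop (𝓝 (1 - 0)⁻¹) := by
        refine Tendsto.inv₀ (Tendsto.const_sub 1 ?_) (by simp)
        have := (continuous_ofReal.tendsto 0).comp Real.tendsto_exp_neg_atTop_nhds_zero
        rw [ofReal_zero] at this
        refine this.congr fun t => ?_
        simp
      have h0 := hexp 0
      simp only [Real.rpow_zero] at h0
      exact (htend.isBigO_one ℝ).trans h0
    · refine IsBigO.trans (IsBigO.of_bound 1 ?_) (hexp ((k : ℝ) - 1))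
      filter_upwards [eventually_gt_atTop 0] with t ht
      rw [norm_cpow_eq_rpow_re_of_pos ht, one_mul, Real.norm_of_nonneg (by positivity)]
      simp
  refine (h1.mul h2).congr_right fun t => ?_
  rw [← Real.exp_add]
  ring_nf

theorem hurwitzRemainder_isBigO_zero {c : ℕ → ℂ} (v : ℂ) {K : ℕ}
    (hc : (fun t : ℝ => (1 - exp (-t))⁻¹ - ∑ k ∈ Finset.range K, c k * (t : ℂ) ^ ((k : ℂ) - 1))
        =O[𝓝[>] 0] fun t : ℝ => t ^ (-(1 - (K : ℝ)))) :
    hurwitzRemainder c v K =O[𝓝[>] 0] fun t : ℝ => t ^ (-(1 - (K : ℝ))) := by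
  have h : (fun t : ℝ => exp (-(v * t))) =O[𝓝[>] 0] fun _ : ℝ => (1 : ℝ) := by
    have : Continuous fun t : ℝ => exp (-(v * t)) := by fun_prop
    exact ((this.tendsto 0).mono_left nhdsWithin_le_nhds).isBigO_one ℝ
  exact (h.mul hc).congr_right fun t => one_mul _

theorem mellin_hurwitzRemainder_zero (c : ℕ → ℂ) {v s : ℂ} (hv : 0 < v.re) (hs : 1 < s.re) :
    mellin (hurwitzRemainder c v 0) s = Gamma s * lerchSeries 1 s v := by
  have h := hasSum_mellin_exp_neg_mul (s := s) (v := v) (by linarith) hv (a := fun _ => 1)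
    (F := fun t => (1 - exp (-t))⁻¹) ?_ ?_
  · have hrem : hurwitzRemainder c v 0 = fun t : ℝ => exp (-(v * t)) * (1 - exp (-t))⁻¹ := by
      ext t
      simp [hurwitzRemainder]
    rw [hrem, ← h.tsum_eq, tsum_mul_left, lerchSeries]
    simp
  · intro t ht
    have hlt : ‖exp (-(t : ℂ))‖ < 1 := by
      rw [norm_exp]; simpa using ht
    simpa using hasSum_geometric_of_norm_lt_one hlt
  · simpa using summable_norm_pow_mul_rpow (σ := s.re) (z := 1) hv 0 (Or.inr ⟨by simp, hs⟩)

/-- After `K` terms are subtracted the integrand is `O(t^{K-1})` at `0`, so its Mellin transform is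
holomorphic for `Re s > 1 - K`. The subtracted terms are Gamma integrals `Γ(s-1+k) v^{-(s-1+k)}`.
Dividing by `Γ(s-1)` rather than `Γ(s)` yields the factor `s - 1` and turns the Gamma quotients into
polynomials. -/
theorem exists_hurwitz_entire {v : ℂ} (hv : 0 < v.re) :
    ∃ g : ℂ → ℂ, Differentiable ℂ g ∧ ∀ s : ℂ, 1 < s.re → g s = (s - 1) * lerchSeries 1 s v := by
  obtain ⟨c, hc⟩ := exists_isBigO_inv_one_sub_exp_neg
  have hv0 : v ≠ 0 := fun h => by simp [h] at hv
  have hloc : ∀ K, LocallyIntegrableOn (hurwitzRemainder c v K) (Ioi 0) := fun K =>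
    (continuousOn_hurwitzRemainder c v K).locallyIntegrableOn measurableSet_Ioi
  refine exists_entire_of_halfPlanes (G := fun K s =>
    (Gamma (s - 1))⁻¹ * mellin (hurwitzRemainder c v K) s
      + ∑ k ∈ Finset.range K, c k * ((∏ i ∈ Finset.range k, (s - 1 + i)) * v ^ (-(s - 1 + k))))
    (fun K s hs => ?_) (fun K s hs => ?_)
  · refine DifferentiableAt.differentiableWithinAt (DifferentiableAt.add
      (DifferentiableAt.mul (differentiable_one_div_Gamma.differentiableAt.comp s (by fun_prop)) ?_)
      (DifferentiableAt.fun_sum fun k _ => ?_))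
    · exact mellin_differentiableAt_of_isBigO_rpow_exp (half_pos hv) (hloc K)
        (hurwitzRemainder_isBigO_atTop c hv K) (hurwitzRemainder_isBigO_zero v (hc K)) hs
    · refine DifferentiableAt.const_mul (DifferentiableAt.mul (by fun_prop) ?_) _
      exact DifferentiableAt.const_cpow (by fun_prop) (Or.inl hv0)
  · have hs1 : 0 < (s - 1).re := by simpa using hs
    have hk : ∀ k : ℕ, 0 < (s - 1 + k).re := fun k => by
      have : (0 : ℝ) ≤ k := k.cast_nonneg
      simp only [add_re, natCast_re]; linarith
    have hΓ : Gamma s = (s - 1) * Gamma (s - 1) := by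
      have h0 : s - 1 ≠ 0 := fun h0 => by simp [h0] at hs1
      rw [← Gamma_add_one _ h0, sub_add_cancel]
    have hint0 : MellinConvergent (hurwitzRemainder c v 0) s :=
      mellinConvergent_of_isBigO_rpow_exp (half_pos hv) (hloc 0)
        (hurwitzRemainder_isBigO_atTop c hv 0) (hurwitzRemainder_isBigO_zero v (hc 0))
        (by simpa using hs)
    have hmel : mellin (hurwitzRemainder c v K) s = Gamma s * lerchSeries 1 s v
        - ∑ k ∈ Finset.range K, c k * (Gamma (s - 1 + k) * v ^ (-(s - 1 + k))) := by
      have hsplit : mellin (hurwitzRemainder c v K) s =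
          ∫ t : ℝ in Ioi 0, ((t : ℂ) ^ (s - 1) • hurwitzRemainder c v 0 t
            - ∑ k ∈ Finset.range K, c k * ((t : ℂ) ^ (s - 1 + k - 1) * exp (-(v * t)))) := by
        refine setIntegral_congr_fun measurableSet_Ioi fun t ht => ?_
        have ht0 : (t : ℂ) ≠ 0 := ofReal_ne_zero.2 (ne_of_gt ht)
        simp only [hurwitzRemainder, smul_eq_mul, Finset.range_zero, Finset.sum_empty, sub_zero,
          mul_sub, Finset.mul_sum]
        congr 1
        refine Finset.sum_congr rfl fun k _ => ?_
        rw [add_sub_assoc, cpow_add _ _ ht0]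
        ring
      have hI : ∀ k : ℕ, IntegrableOn
          (fun t : ℝ => c k * ((t : ℂ) ^ (s - 1 + k - 1) * exp (-(v * t)))) (Ioi 0) := fun k =>
        (integrableOn_cpow_mul_exp_neg_mul (hk k) hv).const_mul _
      rw [hsplit, integral_sub hint0 (integrable_finsetSum _ fun k _ => hI k),
        integral_finsetSum _ fun k _ => hI k, ← mellin_hurwitzRemainder_zero c hv hs, mellin]
      congr 1
      refine Finset.sum_congr rfl fun k _ => ?_
      rw [integral_const_mul, integral_cpow_mul_exp_neg_mul_complex (hk k) hv]
    have hΓ1 : Gamma (s - 1) ≠ 0 := Gamma_ne_zero_of_re_pos hs1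
    simp only [hmel]
    rw [mul_sub, hΓ, Finset.mul_sum]
    have hterm : ∀ k ∈ Finset.range K,
        (Gamma (s - 1))⁻¹ * (c k * (Gamma (s - 1 + k) * v ^ (-(s - 1 + k))))
          = c k * ((∏ i ∈ Finset.range k, (s - 1 + i)) * v ^ (-(s - 1 + k))) := fun k _ => by
      rw [Gamma_add_natCast_eq_prod hs1]
      field_simp
    rw [Finset.sum_congr rfl hterm, sub_add_cancel]
    field_simp

theorem exists_isHurwitzContinuation {v : ℂ} (hv : ∀ j : ℕ, v ≠ -(j : ℂ)) :
    ∃ g, IsHurwitzContinuation v g := by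
  obtain ⟨g, hg, hgs⟩ := exists_hurwitz_entire (re_add_lerchShift_pos v)
  refine ⟨fun s => ∑ j ∈ Finset.range (lerchShift v), (v + j) ^ (-s) + g s / (s - 1),
    fun s hs => ?_, fun s hs => ?_⟩
  · refine DifferentiableAt.differentiableWithinAt (DifferentiableAt.add
      (DifferentiableAt.fun_sum fun j _ => differentiableAt_id.neg.const_cpow (Or.inl ?_))
      (DifferentiableAt.div (hg s) (by fun_prop) (sub_ne_zero.2 hs)))
    exact fun h0 => hv j (eq_neg_of_add_eq_zero_left h0)
  · have hs1 : s - 1 ≠ 0 := fun h0 => by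
      rw [sub_eq_zero] at h0
      simp [h0] at hs
    simp only
    rw [hgs s hs, mul_div_cancel_left₀ _ hs1,
      lerchSeries_eq_sum_add v (Or.inr ⟨by simp, hs⟩) (lerchShift v)]
    simp

theorem isHurwitzContinuation_hurwitzLerchPhi {v : ℂ} (hv : ∀ j : ℕ, v ≠ -(j : ℂ)) :
    IsHurwitzContinuation v (fun s => hurwitzLerchPhi 1 s v) := by
  simpa [hurwitzLerchPhi] using Classical.epsilon_spec (exists_isHurwitzContinuation hv)

/-! ### Permanence of linear relations. -/

/-- An open ray from the origin misses the cut `[1, ∞)` unless it passes through `1`. -/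
theorem mem_lerchCutPlane_of_norm_eq_one {w : ℂ} (hw : ‖w‖ = 1) (h1 : w ≠ 1) {r : ℝ} (hr : 0 < r) :
    (r : ℂ) * w ∈ lerchCutPlane := by
  by_contra h
  rw [lerchCutPlane, mem_ofPred_eq, mem_slitPlane_iff, not_or, not_lt, not_not] at h
  simp only [sub_re, one_re, re_ofReal_mul, sub_im, one_im, im_ofReal_mul] at h
  have him : w.im = 0 := by
    have : r * w.im = 0 := by linarith [h.2]
    exact (mul_eq_zero.1 this).resolve_left hr.ne'
  have hre : 0 < w.re := by
    by_contra hneg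
    nlinarith [h.1]
  apply h1
  have hsq : w.re * w.re + w.im * w.im = 1 := by
    have := normSq_eq_norm_sq w
    rw [hw, normSq_apply] at this
    linarith
  rw [him] at hsq
  apply Complex.ext
  · simp only [one_re]; nlinarith
  · simpa using him

theorem hurwitzLerchPhi_eq_lerchSeries_of_norm_eq_one {z s v : ℂ} (hv : ∀ j : ℕ, v ≠ -(j : ℂ))
    (hz : ‖z‖ = 1) (hs : 1 < s.re) : hurwitzLerchPhi z s v = lerchSeries z s v := by
  by_cases h1 : z = 1
  · subst h1
    exact (isHurwitzContinuation_hurwitzLerchPhi hv).2 s hs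
  · have h := mem_lerchCutPlane_of_norm_eq_one hz h1 one_pos
    rw [ofReal_one, one_mul] at h
    exact hurwitzLerchPhi_eq_lerchSeries_of_norm_le_one v h hz.le hs

theorem differentiableAt_hurwitzLerchPhi_of_norm_eq_one {z s v : ℂ} (h : LerchAdmissible z s v)
    (hz : ‖z‖ = 1) : DifferentiableAt ℂ (fun s => hurwitzLerchPhi z s v) s := by
  by_cases h1 : z = 1
  · subst h1
    have hs : s ≠ 1 := by
      rcases h.2 with h | h | h
      · exact absurd rfl (ne_one_of_mem_lerchCutPlane h)
      · exact h.2
      · exact absurd rfl h.1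
    exact ((isHurwitzContinuation_hurwitzLerchPhi h.1).1 s hs).differentiableAt
      (isOpen_compl_singleton.mem_nhds hs)
  · have := mem_lerchCutPlane_of_norm_eq_one hz h1 one_pos
    rw [ofReal_one, one_mul] at this
    exact differentiable_hurwitzLerchPhi h.1 this s

theorem norm_mul_exp_I_mul {ε : ℂ} (hε : ‖ε‖ = 1) (c : ℝ) (m : ℂ) :
    ‖ε * exp (I * c * m)‖ = Real.exp (-(c * m.im)) := by
  rw [norm_mul, hε, one_mul, norm_exp]
  congr 1
  simp

/-- The direction of the point depends only on `Re m`. As `m` moves vertically the point moves on an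
open ray from the origin, which can meet the cut only if it is the positive real ray. -/
theorem mul_exp_I_mul_eq (ε : ℂ) (c : ℝ) (m : ℂ) :
    ε * exp (I * c * m) = (Real.exp (-(c * m.im)) : ℝ) * (ε * exp (I * c * m.re)) := by
  have h : I * c * m = ((-(c * m.im) : ℝ) : ℂ) + I * c * m.re := by
    conv_lhs => rw [← re_add_im m]
    push_cast
    linear_combination (c * m.im : ℂ) * I_sq
  rw [h, exp_add, ofReal_exp]
  ring

/-- A linear relation between Lerch series at the points `εᵢ e^(i cᵢ m)` that holds where the
series converge absolutely persists for the values of `Φ`, wherever these are defined. -/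
theorem sum_hurwitzLerchPhi_eq_zero {ι : Type*} [Fintype ι] {c : ι → ℝ} (hc : ∀ i, 0 < c i)
    {ε : ι → ℂ} (hε : ∀ i, ‖ε i‖ = 1) {v : ι → ℂ} {C : ι → ℂ → ℂ → ℂ}
    (hCm : ∀ i k, Differentiable ℂ fun m => C i k m) (hCk : ∀ i m, Differentiable ℂ fun k => C i k m)
    {x₀ : ℝ} (hx₀ : ∀ i, ε i * exp (I * c i * x₀) ≠ 1)
    (hseries : ∀ k m : ℂ, 0 < m.im ∨ m.im = 0 ∧ k.re < -1 →
      ∑ i, C i k m * lerchSeries (ε i * exp (I * c i * m)) (-k) (v i) = 0)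
    {k m : ℂ} (hadm : ∀ i, LerchAdmissible (ε i * exp (I * c i * m)) (-k) (v i)) :
    ∑ i, C i k m * hurwitzLerchPhi (ε i * exp (I * c i * m)) (-k) (v i) = 0 := by
  have hv : ∀ i, ∀ j : ℕ, v i ≠ -(j : ℂ) := fun i => (hadm i).1
  have hpos : ∀ m : ℂ, 0 < m.im →
      ∑ i, C i k m * hurwitzLerchPhi (ε i * exp (I * c i * m)) (-k) (v i) = 0 := by
    intro m hm
    rw [← hseries k m (Or.inl hm)]
    refine Finset.sum_congr rfl fun i _ => ?_
    refine congrArg _ ((isLerchContinuation_hurwitzLerchPhi (-k) (v i)).2 _ ?_)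
    rw [norm_mul_exp_I_mul (hε i), Real.exp_lt_one_iff]
    have := mul_pos (hc i) hm
    linarith
  -- If none of the rays is the positive real one, the same holds for nearby `Re m`. The relation is
  -- then holomorphic on a full vertical strip, and it is known in the upper half of that strip.
  have hstrip : ∀ m : ℂ, (∀ i, ε i * exp (I * c i * m.re) ≠ 1) →
      ∑ i, C i k m * hurwitzLerchPhi (ε i * exp (I * c i * m)) (-k) (v i) = 0 := by
    intro m hm
    have hev : ∀ᶠ x : ℝ in 𝓝 m.re, ∀ i, ε i * exp (I * c i * x) ≠ 1 := by
      rw [eventually_all]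
      intro i
      have : Continuous fun x : ℝ => ε i * exp (I * c i * x) := by fun_prop
      exact this.continuousAt.eventually_ne (hm i)
    obtain ⟨δ, hδ, hball⟩ := Metric.eventually_nhds_iff_ball.1 hev
    have hVo : IsOpen (re ⁻¹' Metric.ball m.re δ) := Metric.isOpen_ball.preimage continuous_re
    have hVc : IsPreconnected (re ⁻¹' Metric.ball m.re δ) :=
      ((convex_ball m.re δ).is_linear_preimage reLm.isLinear).isPreconnected
    have hd : DifferentiableOn ℂ (fun m => ∑ i, C i k m *
        hurwitzLerchPhi (ε i * exp (I * c i * m)) (-k) (v i)) (re ⁻¹' Metric.ball m.re δ) := by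
      refine DifferentiableOn.fun_sum fun i _ => ((hCm i k).differentiableOn).mul ?_
      refine (isLerchContinuation_hurwitzLerchPhi (-k) (v i)).1.comp (by fun_prop) fun w hw => ?_
      rw [mul_exp_I_mul_eq]
      refine mem_lerchCutPlane_of_norm_eq_one ?_ (hball _ hw i) (Real.exp_pos _)
      rw [norm_mul_exp_I_mul (hε i)]
      simp
    refine (hd.analyticOnNhd hVo).eqOn_of_preconnected_of_eventuallyEq
      (analyticOnNhd_const (v := (0 : ℂ))) hVc (z₀ := m.re + I) ?_ ?_ ?_
    · simpa using hδ
    · filter_upwards [(isOpen_lt continuous_const continuous_im).mem_nhds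
        (show (0 : ℝ) < (m.re + I : ℂ).im by simp)] with w hw using hpos w hw
    · simpa using hδ
  rcases lt_trichotomy m.im 0 with hm | hm | hm
  · by_cases hgood : ∀ i, ε i * exp (I * c i * m.re) ≠ 1
    · exact hstrip m hgood
    · push Not at hgood
      obtain ⟨i, hi⟩ := hgood
      have hne1 : ∀ i, ∀ w : ℂ, w.im < 0 → ε i * exp (I * c i * w) ≠ 1 := fun i w hw h1 => by
        have h2 := norm_mul_exp_I_mul (hε i) (c i) w
        rw [h1, norm_one, eq_comm, Real.exp_eq_one_iff] at h2
        have := mul_neg_of_pos_of_neg (hc i) hw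
        linarith
      -- The `i`-th point lies on the cut, at modulus greater than `1`, so admissibility leaves only
      -- the rational case.
      obtain ⟨N, hN⟩ : ∃ N : ℕ, -k = -(N : ℂ) := by
        rcases (hadm i).2 with h | h | h
        · exfalso
          rw [mul_exp_I_mul_eq, hi, mul_one] at h
          have hge : 1 ≤ Real.exp (-(c i * m.im)) := Real.one_le_exp (by
            have := mul_neg_of_pos_of_neg (hc i) hm
            linarith)
          rw [lerchCutPlane, mem_ofPred_eq, mem_slitPlane_iff] at h
          rcases h with h | h
          · simp only [sub_re, one_re, ofReal_re] at h
            linarith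
          · rw [sub_im, one_im, ofReal_im, sub_zero] at h
            exact h rfl
        · exact absurd h.1 (hne1 i m hm)
        · exact h.2
      have hLo : IsOpen {w : ℂ | w.im < 0} := isOpen_lt continuous_im continuous_const
      have hd : DifferentiableOn ℂ (fun m => ∑ i, C i k m *
          hurwitzLerchPhi (ε i * exp (I * c i * m)) (-k) (v i)) {w : ℂ | w.im < 0} := by
        refine DifferentiableOn.fun_sum fun i _ => ((hCm i k).differentiableOn).mul ?_
        rw [hN]
        refine DifferentiableOn.congr (f := fun w => lerchRational (v i) N (ε i * exp (I * c i * w)))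
          ?_ fun w hw => hurwitzLerchPhi_neg_natCast _ _ (hne1 i w hw)
        exact (differentiableOn_lerchRational (v i) N).comp (by fun_prop) fun w hw => hne1 i w hw
      -- In the rational case every term is holomorphic on the lower half-plane, where no point
      -- equals `1`. The abscissa `x₀` supplies a strip on which the relation already holds.
      refine (hd.analyticOnNhd hLo).eqOn_of_preconnected_of_eventuallyEq
        (analyticOnNhd_const (v := (0 : ℂ))) (convex_halfSpace_im_lt 0).isPreconnected
        (z₀ := x₀ - I) (by simp) ?_ hm
      have hev : ∀ᶠ w : ℂ in 𝓝 (x₀ - I), ∀ i, ε i * exp (I * c i * w.re) ≠ 1 := by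
        rw [eventually_all]
        intro i
        have : Continuous fun w : ℂ => ε i * exp (I * c i * w.re) := by fun_prop
        exact this.continuousAt.eventually_ne (by simpa using hx₀ i)
      filter_upwards [hev] with w hw using hstrip w hw
  · have hnorm : ∀ i, ‖ε i * exp (I * c i * m)‖ = 1 := fun i => by
      rw [norm_mul_exp_I_mul (hε i), hm]
      simp
    have hat : ∀ k : ℂ, (∀ i, LerchAdmissible (ε i * exp (I * c i * m)) (-k) (v i)) →
        DifferentiableAt ℂ (fun k => ∑ i, C i k m *
          hurwitzLerchPhi (ε i * exp (I * c i * m)) (-k) (v i)) k := by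
      intro k hk
      refine DifferentiableAt.fun_sum fun i _ => (hCk i m k).mul ?_
      exact (differentiableAt_hurwitzLerchPhi_of_norm_eq_one (hk i) (hnorm i)).comp k
        differentiableAt_id.neg
    have hadm' : ∀ k : ℂ, k ≠ -1 →
        ∀ i, LerchAdmissible (ε i * exp (I * c i * m)) (-k) (v i) := by
      intro k hk i
      refine ⟨hv i, ?_⟩
      by_cases h1 : ε i * exp (I * c i * m) = 1
      · exact Or.inr (Or.inl ⟨h1, fun h => hk (by rw [← h, neg_neg])⟩)
      · have := mem_lerchCutPlane_of_norm_eq_one (hnorm i) h1 one_pos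
        rw [ofReal_one, one_mul] at this
        exact Or.inl this
    have hoff : EqOn (fun k => ∑ i, C i k m *
          hurwitzLerchPhi (ε i * exp (I * c i * m)) (-k) (v i)) (fun _ => 0) {(-1 : ℂ)}ᶜ := by
      have hd : DifferentiableOn ℂ (fun k => ∑ i, C i k m *
          hurwitzLerchPhi (ε i * exp (I * c i * m)) (-k) (v i)) {(-1 : ℂ)}ᶜ := fun k hk =>
        (hat k (hadm' k hk)).differentiableWithinAt
      refine (hd.analyticOnNhd isOpen_compl_singleton).eqOn_of_preconnected_of_eventuallyEq
        (analyticOnNhd_const (v := (0 : ℂ)))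
        (isConnected_compl_singleton_of_one_lt_rank (by simp) _).isPreconnected (z₀ := -2)
        (by norm_num) ?_
      filter_upwards [(isOpen_lt continuous_re continuous_const).mem_nhds
        (show (-2 : ℂ).re < -1 by norm_num)] with w hw
      have hw' : w.re < -1 := hw
      rw [← hseries w m (Or.inr ⟨hm, hw'⟩)]
      refine Finset.sum_congr rfl fun i _ => ?_
      rw [hurwitzLerchPhi_eq_lerchSeries_of_norm_eq_one (hv i) (hnorm i)]
      rw [neg_re]
      linarith
    -- At `k = -1` admissibility excludes `z = 1`, so all terms are continuous in `k` there and the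
    -- relation follows by a limit.
    by_cases hk : k = -1
    · subst hk
      have hcont := (hat (-1) hadm).continuousAt
      refine tendsto_nhds_unique (l := 𝓝[≠] (-1 : ℂ))
        (hcont.tendsto.mono_left nhdsWithin_le_nhds) (tendsto_const_nhds.congr' ?_)
      filter_upwards [self_mem_nhdsWithin] with w hw using (hoff hw).symm
    · exact hoff hk
  · exact hpos m hm

/-! ### Parity splitting and the telescoping relation for series. -/

theorem ofReal_mul_cpow_of_pos {r : ℝ} (hr : 0 < r) (w k : ℂ) :
    ((r : ℂ) * w) ^ k = (r : ℂ) ^ k * w ^ k := by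
  rcases eq_or_ne w 0 with rfl | hw
  · rcases eq_or_ne k 0 with rfl | hk
    · simp
    · simp [hk]
  · have hr0 : (r : ℂ) ≠ 0 := ofReal_ne_zero.2 hr.ne'
    -- A positive factor does not change the argument, so the principal logarithms add with no
    -- branch correction.
    rw [cpow_def_of_ne_zero (mul_ne_zero hr0 hw), cpow_def_of_ne_zero hr0, cpow_def_of_ne_zero hw,
      log_ofReal_mul hr hw, ofReal_log hr.le, ← exp_add, add_mul]

theorem two_mul_cpow (w k : ℂ) : (2 * w) ^ k = 2 ^ k * w ^ k := by
  simpa using ofReal_mul_cpow_of_pos two_pos w k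

/-- Splitting the Lerch series into its terms of even and of odd index. -/
theorem lerchSeries_even_odd {z s : ℂ} (v : ℂ) (h : ‖z‖ < 1 ∨ ‖z‖ ≤ 1 ∧ 1 < s.re) :
    lerchSeries z s v = 2 ^ (-s) *
      (lerchSeries (z ^ 2) s (v / 2) + z * lerchSeries (z ^ 2) s ((v + 1) / 2)) := by
  have hsum := (summable_norm_lerchSeries v h).of_norm
  have he : Summable fun j : ℕ => (v + (2 * j : ℕ)) ^ (-s) * z ^ (2 * j) :=
    hsum.comp_injective (i := fun j : ℕ => 2 * j) fun a b hab => by simpa using hab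
  have ho : Summable fun j : ℕ => (v + (2 * j + 1 : ℕ)) ^ (-s) * z ^ (2 * j + 1) :=
    hsum.comp_injective (i := fun j : ℕ => 2 * j + 1) fun a b hab => by simpa using hab
  simp only [lerchSeries]
  rw [← tsum_even_add_odd (f := fun j : ℕ => (v + j) ^ (-s) * z ^ j) he ho, mul_add,
    ← tsum_mul_left, ← tsum_mul_left, ← tsum_mul_left]
  congr 1
  · refine tsum_congr fun j => ?_
    have hb : v + ((2 * j : ℕ) : ℂ) = 2 * (v / 2 + j) := by push_cast; ring
    rw [hb, two_mul_cpow, pow_mul, mul_assoc]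
  · refine tsum_congr fun j => ?_
    have hb : v + ((2 * j + 1 : ℕ) : ℂ) = 2 * ((v + 1) / 2 + j) := by push_cast; ring
    rw [hb, two_mul_cpow, pow_succ, pow_mul]
    ring

theorem lerchSeries_neg {z s : ℂ} (v : ℂ) (h : ‖z‖ < 1 ∨ ‖z‖ ≤ 1 ∧ 1 < s.re) :
    lerchSeries (-z) s v = lerchSeries z s v
      - 2 * 2 ^ (-s) * z * lerchSeries (z ^ 2) s ((v + 1) / 2) := by
  rw [lerchSeries_even_odd v h, lerchSeries_even_odd (z := -z) v (by rwa [norm_neg]), neg_sq]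
  ring

theorem two_zpow_mul_cpow (p : ℤ) (k : ℂ) :
    (I * (2 : ℂ) ^ (-p + 1)) ^ k = 2 ^ k * (I * (2 : ℂ) ^ (-p)) ^ k := by
  rw [← two_mul_cpow, zpow_add₀ two_ne_zero, zpow_one]
  ring_nf

theorem exp_zpow_succ (p : ℤ) (m : ℂ) :
    exp (I * (2 : ℂ) ^ (p + 1) * m) = exp (I * (2 : ℂ) ^ p * m) ^ 2 := by
  rw [← exp_nat_mul, zpow_add₀ two_ne_zero]
  congr 1
  push_cast
  ring

theorem lerch_summable_condition {k m : ℂ} (h : 0 < m.im ∨ m.im = 0 ∧ k.re < -1) (p : ℤ) :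
    ‖exp (I * (2 : ℂ) ^ p * m)‖ < 1 ∨ ‖exp (I * (2 : ℂ) ^ p * m)‖ ≤ 1 ∧ 1 < (-k).re := by
  have hn := norm_mul_exp_I_mul (norm_one (α := ℂ)) ((2 : ℝ) ^ p) m
  push_cast at hn
  rw [one_mul] at hn
  rw [hn]
  rcases h with h | ⟨h, hk⟩
  · left
    rw [Real.exp_lt_one_iff]
    have : 0 < (2 : ℝ) ^ p * m.im := by positivity
    linarith
  · right
    rw [h, neg_re]
    exact ⟨by simp, by linarith⟩

/-- The Lerch series at level `p` that telescopes. -/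
noncomputable def oddLerch (k m l : ℂ) (p : ℤ) : ℂ :=
  (2 : ℂ) ^ (-p) * (I * (2 : ℂ) ^ (-p)) ^ k * exp (I * (2 : ℂ) ^ (-p) * m) *
    lerchSeries (exp (I * (2 : ℂ) ^ (-p) * m) ^ 2) (-k) ((1 - I * 2 ^ p * l) / 2)

/-- The full Lerch series at level `p`. -/
noncomputable def fullLerch (k m l : ℂ) (p : ℤ) : ℂ :=
  (2 : ℂ) ^ (-p) * (I * (2 : ℂ) ^ (-p)) ^ k * exp (I * (2 : ℂ) ^ (-p + 1) * m) *
    lerchSeries (exp (I * (2 : ℂ) ^ (-p + 1) * m)) (-k) (1 - I * 2 ^ (p - 1) * l)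

/-- The alternating Lerch series at level `p`. -/
noncomputable def alternatingLerch (k m l : ℂ) (p : ℤ) : ℂ :=
  (2 : ℂ) ^ (-p) * (I * (2 : ℂ) ^ (-p)) ^ k * exp (I * (2 : ℂ) ^ (-p + 1) * m) *
    lerchSeries (-exp (I * (2 : ℂ) ^ (-p + 1) * m)) (-k) (1 - I * 2 ^ (p - 1) * l)

/-- The sign change subtracts twice the odd half. The prefactor absorbs `2 · 2^k`, and what is
subtracted is the full series one level down. -/
theorem alternatingLerch_eq {k m : ℂ} (l : ℂ) (h : 0 < m.im ∨ m.im = 0 ∧ k.re < -1) (p : ℤ) :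
    alternatingLerch k m l p = fullLerch k m l p - fullLerch k m l (p - 1) := by
  have hv : (1 - I * (2 : ℂ) ^ (p - 1) * l + 1) / 2 = 1 - I * 2 ^ (p - 1 - 1) * l := by
    rw [zpow_sub_one₀ two_ne_zero (p - 1)]
    ring
  have hp : -(p - 1) = -p + 1 := by ring
  rw [alternatingLerch, fullLerch, fullLerch, lerchSeries_neg _ (lerch_summable_condition h _), hv,
    hp, two_zpow_mul_cpow, exp_zpow_succ (-p + 1), zpow_add_one₀ two_ne_zero (-p), neg_neg]
  ring

/-- The odd half of the doubled series at level `p + 1` is the full series at level `p`. Only even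
indices remain; with the outer exponential they carry the odd powers of `e^{i2^{-p}m}`. -/
theorem two_mul_fullLerch_sub {k m : ℂ} (l : ℂ) (h : 0 < m.im ∨ m.im = 0 ∧ k.re < -1) (p : ℤ) :
    2 * fullLerch k m l (p + 1) - fullLerch k m l p = oddLerch k m l p := by
  have hv : (1 - I * (2 : ℂ) ^ p * l + 1) / 2 = 1 - I * 2 ^ (p - 1) * l := by
    rw [zpow_sub_one₀ two_ne_zero]
    ring
  have hp : -p = -(p + 1) + 1 := by ring
  have hp' : (2 : ℂ) ^ (-p) = 2 * 2 ^ (-(p + 1)) := by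
    rw [hp, zpow_add_one₀ two_ne_zero, mul_comm]
  have hI : (I * (2 : ℂ) ^ (-p)) ^ k = 2 ^ k * (I * (2 : ℂ) ^ (-(p + 1))) ^ k := by
    rw [← two_zpow_mul_cpow, ← hp]
  rw [fullLerch, fullLerch, oddLerch, ← hp, add_sub_cancel_right,
    lerchSeries_even_odd _ (lerch_summable_condition h _), hv, exp_zpow_succ, hI, neg_neg]
  rw [hp']
  ring

theorem alternatingLerch_telescope {k m : ℂ} (l : ℂ) (h : 0 < m.im ∨ m.im = 0 ∧ k.re < -1)
    (p : ℤ) : alternatingLerch k m l p - 2 * alternatingLerch k m l (p + 1)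
      = oddLerch k m l (p - 1) - oddLerch k m l p := by
  rw [alternatingLerch_eq l h, alternatingLerch_eq l h, ← two_mul_fullLerch_sub l h,
    ← two_mul_fullLerch_sub l h, sub_add_cancel, add_sub_cancel_right]
  ring

theorem sum_alternatingLerch {k m : ℂ} (l : ℂ) (h : 0 < m.im ∨ m.im = 0 ∧ k.re < -1) (n : ℕ) :
    ∑ p ∈ Finset.range (n + 1),
      (alternatingLerch k m l p - 2 * alternatingLerch k m l ((p : ℤ) + 1))
      = oddLerch k m l (-1) - oddLerch k m l n := by
  induction n with
  | zero => simpa using alternatingLerch_telescope l h 0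
  | succ n ih =>
    rw [Finset.sum_range_succ, ih, alternatingLerch_telescope l h]
    push_cast
    rw [add_sub_cancel_right]
    ring

/-! ### Assembly of the theorem. -/

theorem exp_I_mul_im_ne_zero {θ : ℝ} (h0 : 0 < θ) (h1 : θ ≤ 2) : (exp (I * θ)).im ≠ 0 := by
  rw [mul_comm, exp_ofReal_mul_I_im]
  exact (Real.sin_pos_of_pos_of_lt_pi h0 (by linarith [Real.pi_gt_three])).ne'

theorem two_zpow_le_four {p : ℤ} (hp : p ≤ 2) : (2 : ℝ) ^ p ≤ 4 :=
  (zpow_le_zpow_right₀ one_le_two hp).trans (by norm_num)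

theorem I_mul_two_zpow_ne_zero (p : ℤ) : I * (2 : ℂ) ^ p ≠ 0 :=
  mul_ne_zero I_ne_zero (zpow_ne_zero _ two_ne_zero)

theorem mainTheorem1 (k a m : ℂ) (n : ℕ) (hn : 0 < n)
    (loga : ℂ) (hloga : Complex.exp loga = a)
    (h₁ : ∀ p ∈ Finset.range (n + 1),
      LerchAdmissible (-Complex.exp (Complex.I * (2 : ℂ) ^ (1 - (p : ℤ)) * m)) (-k)
        (1 - Complex.I * (2 : ℂ) ^ ((p : ℤ) - 1) * loga))
    (h₂ : ∀ p ∈ Finset.range (n + 1),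
      LerchAdmissible (-Complex.exp (Complex.I * (2 : ℂ) ^ (-(p : ℤ)) * m)) (-k)
        (1 - Complex.I * (2 : ℂ) ^ (p : ℤ) * loga))
    (h₃ : LerchAdmissible (Complex.exp (Complex.I * (2 : ℂ) ^ (1 - (n : ℤ)) * m)) (-k)
        (1 / 2 * (1 - Complex.I * (2 : ℂ) ^ (n : ℤ) * loga)))
    (h₄ : LerchAdmissible (Complex.exp (4 * Complex.I * m)) (-k)
        (1 / 2 - 1 / 4 * Complex.I * loga)) :
    ∑ p ∈ Finset.range (n + 1),
      (2 : ℂ) ^ (-(p : ℤ)) * Complex.exp (Complex.I * m * (2 : ℂ) ^ (-(p : ℤ))) *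
        ((Complex.I * (2 : ℂ) ^ (-(p : ℤ))) ^ k *
            Complex.exp (Complex.I * m * (2 : ℂ) ^ (-(p : ℤ))) *
            hurwitzLerchPhi (-Complex.exp (Complex.I * (2 : ℂ) ^ (1 - (p : ℤ)) * m)) (-k)
              (1 - Complex.I * (2 : ℂ) ^ ((p : ℤ) - 1) * loga)
          - (Complex.I * (2 : ℂ) ^ (-(p : ℤ) - 1)) ^ k *
            hurwitzLerchPhi (-Complex.exp (Complex.I * (2 : ℂ) ^ (-(p : ℤ)) * m)) (-k)
              (1 - Complex.I * (2 : ℂ) ^ (p : ℤ) * loga))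
    = Complex.I * (Complex.I * (2 : ℂ) ^ (-(n : ℤ))) ^ (k + 1) *
          Complex.exp (Complex.I * m * (2 : ℂ) ^ (-(n : ℤ))) *
          hurwitzLerchPhi (Complex.exp (Complex.I * (2 : ℂ) ^ (1 - (n : ℤ)) * m)) (-k)
            (1 / 2 * (1 - Complex.I * (2 : ℂ) ^ (n : ℤ) * loga))
      + Complex.I ^ k * (2 : ℂ) ^ (k + 1) * Complex.exp (2 * Complex.I * m) *
          hurwitzLerchPhi (Complex.exp (4 * Complex.I * m)) (-k)
            (1 / 2 - 1 / 4 * Complex.I * loga) := by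
  -- All terms are moved to one side and indexed by one finite type: the two families in the sum,
  -- then the two terms on the right.
  let c : Fin (n + 1) ⊕ Fin (n + 1) ⊕ Unit ⊕ Unit → ℝ :=
    Sum.elim (fun p => 2 ^ (1 - ((p : ℕ) : ℤ))) <| Sum.elim (fun p => 2 ^ (-((p : ℕ) : ℤ))) <|
      Sum.elim (fun _ => 2 ^ (1 - (n : ℤ))) fun _ => 4
  let ε : Fin (n + 1) ⊕ Fin (n + 1) ⊕ Unit ⊕ Unit → ℂ :=
    Sum.elim (fun _ => -1) <| Sum.elim (fun _ => -1) <| Sum.elim (fun _ => 1) fun _ => 1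
  let v : Fin (n + 1) ⊕ Fin (n + 1) ⊕ Unit ⊕ Unit → ℂ :=
    Sum.elim (fun p => 1 - I * (2 : ℂ) ^ (((p : ℕ) : ℤ) - 1) * loga) <|
      Sum.elim (fun p => 1 - I * (2 : ℂ) ^ ((p : ℕ) : ℤ) * loga) <|
      Sum.elim (fun _ => 1 / 2 * (1 - I * (2 : ℂ) ^ (n : ℤ) * loga))
        fun _ => 1 / 2 - 1 / 4 * I * loga
  let C : Fin (n + 1) ⊕ Fin (n + 1) ⊕ Unit ⊕ Unit → ℂ → ℂ → ℂ :=
    Sum.elim (fun p k m => (2 : ℂ) ^ (-((p : ℕ) : ℤ)) * exp (I * m * (2 : ℂ) ^ (-((p : ℕ) : ℤ))) *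
      ((I * (2 : ℂ) ^ (-((p : ℕ) : ℤ))) ^ k * exp (I * m * (2 : ℂ) ^ (-((p : ℕ) : ℤ))))) <|
    Sum.elim (fun p k m => -((2 : ℂ) ^ (-((p : ℕ) : ℤ)) * exp (I * m * (2 : ℂ) ^ (-((p : ℕ) : ℤ))) *
      (I * (2 : ℂ) ^ (-((p : ℕ) : ℤ) - 1)) ^ k)) <|
    Sum.elim (fun _ k m => -(I * (I * (2 : ℂ) ^ (-(n : ℤ))) ^ (k + 1) *
      exp (I * m * (2 : ℂ) ^ (-(n : ℤ)))))
      fun _ k m => -(I ^ k * (2 : ℂ) ^ (k + 1) * exp (2 * I * m))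
  -- Leaving `φ` arbitrary lets the same bookkeeping serve for `Φ` and for the series.
  have hexpand : ∀ (φ : ℂ → ℂ → ℂ → ℂ) (k m : ℂ),
      ∑ i, C i k m * φ (ε i * exp (I * c i * m)) (-k) (v i) =
        ∑ p ∈ Finset.range (n + 1),
          (2 : ℂ) ^ (-(p : ℤ)) * exp (I * m * (2 : ℂ) ^ (-(p : ℤ))) *
            ((I * (2 : ℂ) ^ (-(p : ℤ))) ^ k * exp (I * m * (2 : ℂ) ^ (-(p : ℤ))) *
                φ (-exp (I * (2 : ℂ) ^ (1 - (p : ℤ)) * m)) (-k)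
                  (1 - I * (2 : ℂ) ^ ((p : ℤ) - 1) * loga)
              - (I * (2 : ℂ) ^ (-(p : ℤ) - 1)) ^ k *
                φ (-exp (I * (2 : ℂ) ^ (-(p : ℤ)) * m)) (-k) (1 - I * (2 : ℂ) ^ (p : ℤ) * loga))
        - (I * (I * (2 : ℂ) ^ (-(n : ℤ))) ^ (k + 1) * exp (I * m * (2 : ℂ) ^ (-(n : ℤ))) *
            φ (exp (I * (2 : ℂ) ^ (1 - (n : ℤ)) * m)) (-k)
              (1 / 2 * (1 - I * (2 : ℂ) ^ (n : ℤ) * loga))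
          + I ^ k * (2 : ℂ) ^ (k + 1) * exp (2 * I * m) *
            φ (exp (4 * I * m)) (-k) (1 / 2 - 1 / 4 * I * loga)) := by
    intro φ k m
    rw [← Fin.sum_univ_eq_sum_range (fun p : ℕ =>
          (2 : ℂ) ^ (-(p : ℤ)) * exp (I * m * (2 : ℂ) ^ (-(p : ℤ))) *
            ((I * (2 : ℂ) ^ (-(p : ℤ))) ^ k * exp (I * m * (2 : ℂ) ^ (-(p : ℤ))) *
                φ (-exp (I * (2 : ℂ) ^ (1 - (p : ℤ)) * m)) (-k)
                  (1 - I * (2 : ℂ) ^ ((p : ℤ) - 1) * loga)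
              - (I * (2 : ℂ) ^ (-(p : ℤ) - 1)) ^ k *
                φ (-exp (I * (2 : ℂ) ^ (-(p : ℤ)) * m)) (-k)
                  (1 - I * (2 : ℂ) ^ (p : ℤ) * loga)))]
    simp only [Fintype.sum_sum_type, c, ε, v, C, Sum.elim_inl, Sum.elim_inr, Finset.univ_unique,
      Finset.sum_singleton, ofReal_zpow, ofReal_ofNat, neg_one_mul, one_mul, mul_comm I 4]
    rw [← add_assoc, ← Finset.sum_add_distrib, neg_mul, neg_mul, ← neg_add, ← sub_eq_add_neg]
    congr 1
    refine Finset.sum_congr rfl fun p _ => ?_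
    ring
  rw [← sub_eq_zero, ← hexpand hurwitzLerchPhi k m]
  have hc : ∀ i, 0 < c i ∧ c i ≤ 4 := by
    rintro (p | p | _ | _)
    · exact ⟨by simp only [c, Sum.elim_inl]; positivity, two_zpow_le_four (by omega)⟩
    · exact ⟨by simp only [c, Sum.elim_inl, Sum.elim_inr]; positivity,
        two_zpow_le_four (by omega)⟩
    · exact ⟨by simp only [c, Sum.elim_inl, Sum.elim_inr]; positivity,
        two_zpow_le_four (by omega)⟩
    · exact ⟨by simp only [c, Sum.elim_inr]; positivity, le_rfl⟩
  have hε : ∀ i, ε i = 1 ∨ ε i = -1 := by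
    rintro (p | p | _ | _) <;> simp [ε]
  -- All frequencies lie in `(0, 4]`, so at `x₀ = 1/2` the angles lie in `(0, 2]`, inside `(0, π)`:
  -- no point is real, whatever the sign.
  refine sum_hurwitzLerchPhi_eq_zero (fun i => (hc i).1) ?_ ?_ ?_ (x₀ := 1 / 2) ?_ ?_ ?_
  · intro i
    rcases hε i with h | h <;> simp [h]
  · rintro (p | p | _ | _) k <;> simp only [C, Sum.elim_inl, Sum.elim_inr] <;> fun_prop
  · have hcpow : ∀ p : ℤ, Differentiable ℂ fun k : ℂ => (I * (2 : ℂ) ^ p) ^ k := fun p =>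
      differentiable_id.const_cpow (Or.inl (I_mul_two_zpow_ne_zero p))
    have hcpow' : ∀ p : ℤ, Differentiable ℂ fun k : ℂ => (I * (2 : ℂ) ^ p) ^ (k + 1) := fun p =>
      (differentiable_id.add_const 1).const_cpow (Or.inl (I_mul_two_zpow_ne_zero p))
    have hI : Differentiable ℂ fun k : ℂ => I ^ k :=
      differentiable_id.const_cpow (Or.inl I_ne_zero)
    have h2 : Differentiable ℂ fun k : ℂ => (2 : ℂ) ^ (k + 1) :=
      (differentiable_id.add_const 1).const_cpow (Or.inl two_ne_zero)
    rintro (p | p | _ | _) m <;> simp only [C, Sum.elim_inl, Sum.elim_inr]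
    · exact ((hcpow _).mul_const _).const_mul _
    · exact ((hcpow _).const_mul _).neg
    · exact (((hcpow' _).const_mul _).mul_const _).neg
    · exact ((hI.mul h2).mul_const _).neg
  · intro i h
    have him := congrArg im h
    have hne := exp_I_mul_im_ne_zero (θ := c i * (1 / 2)) (by linarith [(hc i).1])
      (by linarith [(hc i).2])
    rw [ofReal_mul, ← mul_assoc] at hne
    rcases hε i with hi | hi <;> rw [hi] at him
    · rw [one_mul] at him
      exact hne him
    · rw [neg_one_mul, neg_im, one_im, neg_eq_zero] at him
      exact hne him
  · intro k m hkm
    rw [hexpand lerchSeries k m, sub_eq_zero]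
    have hsum := sum_alternatingLerch loga hkm n
    have hcomm : ∀ p : ℤ, exp (I * m * (2 : ℂ) ^ p) = exp (I * (2 : ℂ) ^ p * m) := fun p => by
      rw [mul_right_comm]
    have hsq : ∀ p : ℤ, exp (I * (2 : ℂ) ^ (1 - p) * m) = exp (I * (2 : ℂ) ^ (-p) * m) ^ 2 :=
      fun p => by rw [← exp_zpow_succ, neg_add_eq_sub]
    -- The sign comes from `i · i = -1`: one factor is explicit, the other comes from the exponent
    -- `k + 1`.
    have hn : -oddLerch k m loga n =
        I * (I * (2 : ℂ) ^ (-(n : ℤ))) ^ (k + 1) * exp (I * m * (2 : ℂ) ^ (-(n : ℤ))) *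
          lerchSeries (exp (I * (2 : ℂ) ^ (1 - (n : ℤ)) * m)) (-k)
            (1 / 2 * (1 - I * (2 : ℂ) ^ (n : ℤ) * loga)) := by
      rw [oddLerch, cpow_add _ _ (I_mul_two_zpow_ne_zero _), cpow_one, hcomm, hsq,
        one_div_mul_eq_div]
      linear_combination (-(I * (2 : ℂ) ^ (-(n : ℤ))) ^ k * (2 : ℂ) ^ (-(n : ℤ)) *
        exp (I * (2 : ℂ) ^ (-(n : ℤ)) * m) * lerchSeries (exp (I * (2 : ℂ) ^ (-(n : ℤ)) * m) ^ 2)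
          (-k) ((1 - I * (2 : ℂ) ^ (n : ℤ) * loga) / 2)) * I_sq
    have hneg : oddLerch k m loga (-1) = I ^ k * (2 : ℂ) ^ (k + 1) * exp (2 * I * m) *
          lerchSeries (exp (4 * I * m)) (-k) (1 / 2 - 1 / 4 * I * loga) := by
      have h4 : exp (4 * I * m) = exp (2 * I * m) ^ 2 := by
        rw [← exp_nat_mul]
        push_cast
        ring_nf
      have hv : (1 - I * (2 : ℂ) ^ (-1 : ℤ) * loga) / 2 = 1 / 2 - 1 / 4 * I * loga := by
        rw [zpow_neg_one]
        ring
      rw [oddLerch, hv, neg_neg, zpow_one, mul_comm I 2, two_mul_cpow, ← h4,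
        cpow_add _ _ two_ne_zero, cpow_one]
      ring
    rw [← hn, ← hneg, neg_add_eq_sub, ← hsum]
    refine Finset.sum_congr rfl fun p _ => ?_
    have hp : -((p : ℤ) + 1) = -(p : ℤ) - 1 := by ring
    -- The second term of the summand has prefactor `2^{-p}`, whereas level `p + 1` carries
    -- `2^{-p-1}`; this is the factor `2` in the telescoping relation.
    have h2 : (2 : ℂ) ^ (-(p : ℤ)) = 2 * 2 ^ (-(p : ℤ) - 1) := by
      rw [zpow_sub_one₀ two_ne_zero]
      ring
    rw [alternatingLerch, alternatingLerch, hp, sub_add_cancel, add_sub_cancel_right, hcomm,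
      neg_add_eq_sub, hsq]
    linear_combination -(exp (I * (2 : ℂ) ^ (-(p : ℤ)) * m) * (I * (2 : ℂ) ^ (-(p : ℤ) - 1)) ^ k *
      lerchSeries (-exp (I * (2 : ℂ) ^ (-(p : ℤ)) * m)) (-k)
        (1 - I * (2 : ℂ) ^ (p : ℤ) * loga)) * h2
  · rintro (p | p | _ | _)
    · simpa [c, ε, v] using h₁ p (Finset.mem_range.2 p.2)
    · simpa [c, ε, v] using h₂ p (Finset.mem_range.2 p.2)
    · simpa [c, ε, v] using h₃
    · simpa [c, ε, v, mul_comm I 4] using h₄
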